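/- Let $M,N\ge 3$ and $K>0$. A spherical quadrilateral kirigami (SQK) tessellation with $M$ columns and $N$ rows is cut from the sphere of Gaussian curvature $K$ by geodesic slits (minor arcs of great circles): the quadrilateral panels $(i,j)$, $1\le i\le M$, $1\le j\le N$, are such that two panels that are neighbours in a row or in a column are joined at one common corner by a free rotational hinge, and the four hinges between the panels $(i,j),(i+1,j),(i+1,j+1),(i,j+1)$ lie on one slit. The slits are alternately horizontal and vertical, as on a chessboard: the two end points of a horizontal (vertical) slit are its left and right (bottom and top) hinges, and the other two hinges are interior points of the slit. In particular each slit, regarded as a closed quadrilateral void with its hinges as vertices, has consecutive side lengths $a,b,c,d$ with $a+b=c+d<\pi/\sqrt K$. Each panel that is not at the boundary is a convex quadrilateral with all angles in $(0,\pi)$. A compatible configuration is a placement of all panels on the sphere, each moved by a rotation of the sphere, such that the two panels at each hinge still meet at this hinge, and such that each slit becomes a (possibly degenerate) quadrilateral void, correctly oriented, with its four opening angles in $[0,\pi]$. Placements that differ by a rotation of the whole sphere are the same configuration. Then the undeployed state (no panel is moved) is a compatible configuration, and the tessellation has either exactly one or exactly two compatible configurations. -/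

import Mathlib

open scoped Matrix

noncomputable section

namespace Kirigami

/-- Vectors of Euclidean three-space, in coordinates; inner products and lengths are taken with
`⬝ᵥ`. -/
abbrev Vec3 : Type := Fin 3 → ℝ

/-- The rotation group `SO(3)`: the orientation-preserving isometries of a sphere centred at the
origin. -/
abbrev Rotation : Type := Matrix.specialOrthogonalGroup (Fin 3) ℝ

/-- `p` lies on the sphere of Gaussian curvature `K > 0`, i.e. of radius `1 / √K`, centred at the
origin. -/
def OnSphere (K : ℝ) (p : Vec3) : Prop := p ⬝ᵥ p = 1 / K

/-- The triple product `det (p, q, r)`. For points of the sphere, with `p` and `r` distinct from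
`± q`, it is a positive multiple of `sin θ`, where `θ ∈ [0, 2π)` is the angle at `q` which is swept
when the geodesic direction from `q` to `r` is turned counterclockwise (seen from outside the
sphere) to the geodesic direction from `q` to `p`. So it is nonnegative iff `θ ∈ [0, π]` and
positive iff `θ ∈ (0, π)`. For a polygon which is traversed counterclockwise and has `p, q, r` as
consecutive vertices, `θ` is the interior angle at `q`. -/
def triple (p q r : Vec3) : ℝ := Matrix.det (Matrix.of ![p, q, r])

/-- For points `p`, `q`, `x` of a sphere centred at the origin: `p` and `q` are neither equal nor
antipodal, and `x` is an interior point of the minor arc of a great circle from `p` to `q`. -/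
def OnMinorArc (p q x : Vec3) : Prop :=
  LinearIndependent ℝ ![p, q] ∧ ∃ s t : ℝ, 0 < s ∧ 0 < t ∧ x = s • p + t • q

/-- The quadrilateral with vertices `p, q, r, s`, traversed counterclockwise, has all four interior
angles in `[0, π]`. -/
def WeaklyConvex (p q r s : Vec3) : Prop :=
  0 ≤ triple s p q ∧ 0 ≤ triple p q r ∧ 0 ≤ triple q r s ∧ 0 ≤ triple r s p

/-- The quadrilateral with vertices `p, q, r, s`, traversed counterclockwise, has all four interior
angles in `(0, π)`. -/
def StrictlyConvex (p q r s : Vec3) : Prop :=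
  0 < triple s p q ∧ 0 < triple p q r ∧ 0 < triple q r s ∧ 0 < triple r s p

/-- A spherical quadrilateral kirigami tessellation with `M` columns and `N` rows of panels, on the
sphere of curvature `K`, in its undeployed (compact) state.

Panel `(i, j)`, in column `i` and row `j`, has the four corners `south i j`, `east i j`,
`north i j`, `west i j`, in counterclockwise order. Panels that are neighbours in a row or in a
column are joined by a hinge at exactly one common corner. For each block of four panels
`(i, j)`, `(i+1, j)`, `(i+1, j+1)`, `(i, j+1)`, the four hinges between them,

* bottom: `east i j = west (i+1) j`,
* right: `north (i+1) j = south (i+1) (j+1)`,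
* top: `east i (j+1) = west (i+1) (j+1)`,
* left: `north i j = south i (j+1)`,

lie on one geodesic slit. Horizontal and vertical slits alternate as on a chessboard. A horizontal
slit is a minor arc which runs from the left hinge to the right hinge and has the bottom and the top
hinge in its interior; a vertical slit runs from the bottom hinge to the top hinge and has the left
and the right hinge in its interior. So, at each hinge between two slits, one of them ends at an
interior point of the other, and the slit side lengths satisfy `a + b = c + d`.

A panel which is not at the boundary of the tessellation is bounded by four slits; its angles are
those between crossing slits, hence in `(0, π)`. The corners of the boundary panels that are not
hinges are arbitrary points of the sphere: they play no role in the deployment. -/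
structure SQKTessellation (K : ℝ) (M N : ℕ) where
  south : Fin M → Fin N → Vec3
  east : Fin M → Fin N → Vec3
  north : Fin M → Fin N → Vec3
  west : Fin M → Fin N → Vec3
  south_onSphere : ∀ i j, OnSphere K (south i j)
  east_onSphere : ∀ i j, OnSphere K (east i j)
  north_onSphere : ∀ i j, OnSphere K (north i j)
  west_onSphere : ∀ i j, OnSphere K (west i j)
  /-- Neighbours in a row share a corner. -/
  hinge_row : ∀ (i i' : Fin M) (j : Fin N), i.val + 1 = i'.val → east i j = west i' j
  /-- Neighbours in a column share a corner. -/
  hinge_column : ∀ (i : Fin M) (j j' : Fin N), j.val + 1 = j'.val → north i j = south i j'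
  /-- The first slit is horizontal if this is even, and vertical otherwise. -/
  parity : ℕ
  slit_horizontal : ∀ (i i' : Fin M) (j j' : Fin N), i.val + 1 = i'.val → j.val + 1 = j'.val →
    Even (i.val + j.val + parity) →
      OnMinorArc (north i j) (north i' j) (east i j) ∧
        OnMinorArc (north i j) (north i' j) (east i j')
  slit_vertical : ∀ (i i' : Fin M) (j j' : Fin N), i.val + 1 = i'.val → j.val + 1 = j'.val →
    ¬ Even (i.val + j.val + parity) →
      OnMinorArc (east i j) (east i j') (north i j) ∧
        OnMinorArc (east i j) (east i j') (north i' j)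
  panel_convex : ∀ (i : Fin M) (j : Fin N), 0 < i.val → i.val + 1 < M → 0 < j.val →
    j.val + 1 < N → StrictlyConvex (south i j) (east i j) (north i j) (west i j)

namespace SQKTessellation

variable {K : ℝ} {M N : ℕ}

/-- A placement `R` moves each panel `(i, j)` rigidly along the sphere, by the rotation `R i j`.
It is a compatible configuration if the two panels at each hinge still meet there, and if the void
into which each slit opens, i.e. the quadrilateral with the displaced bottom, right, top and left
hinges as vertices, has its four opening angles in `[0, π]`. (All voids closed is the undeployed
state.) -/
structure IsCompatible (T : SQKTessellation K M N) (R : Fin M → Fin N → Rotation) : Prop where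
  hinge_row : ∀ (i i' : Fin M) (j : Fin N), i.val + 1 = i'.val →
    (R i j).1 *ᵥ T.east i j = (R i' j).1 *ᵥ T.west i' j
  hinge_column : ∀ (i : Fin M) (j j' : Fin N), j.val + 1 = j'.val →
    (R i j).1 *ᵥ T.north i j = (R i j').1 *ᵥ T.south i j'
  opening : ∀ (i i' : Fin M) (j j' : Fin N), i.val + 1 = i'.val → j.val + 1 = j'.val →
    WeaklyConvex ((R i j).1 *ᵥ T.east i j) ((R i' j).1 *ᵥ T.north i' j)
      ((R i j').1 *ᵥ T.east i j') ((R i j).1 *ᵥ T.north i j)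

/-- The undeployed state: no panel is moved. -/
def undeployed (M N : ℕ) : Fin M → Fin N → Rotation := fun _ _ => 1

/-- Two compatible placements are the same configuration if they differ by a rotation of the whole
sphere. -/
def sameConfiguration (T : SQKTessellation K M N) :
    Setoid {R : Fin M → Fin N → Rotation // T.IsCompatible R} where
  r R R' := ∃ Q : Rotation, ∀ i j, R'.1 i j = Q * R.1 i j
  iseqv :=
    { refl := fun _ => ⟨1, fun _ _ => (one_mul _).symm⟩
      symm := fun ⟨Q, h⟩ => ⟨Q⁻¹, fun i j => by rw [h i j, inv_mul_cancel_left]⟩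
      trans := fun ⟨Q, h⟩ ⟨Q', h'⟩ => ⟨Q' * Q, fun i j => by rw [h' i j, h i j, mul_assoc]⟩ }

/-- The compatible configurations of a tessellation, up to rotations of the whole sphere. -/
def CompatibleConfiguration (T : SQKTessellation K M N) : Type :=
  Quotient T.sameConfiguration

end SQKTessellation

end Kirigami

end

/-!
Panels that are hinged at `p` differ by a rotation about `p` by an angle `ω`. At `p`, one of the two
adjacent slits ends and opens by the angle `ω`, and the other one passes through and its void has
the angle `π - ω`; so each hinge has a single opening `P = sin² (ω / 2)`, which is read off from
the trace of the relative rotation (`hingeOpening`).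

Consider a void with end hinges `e₁`, `e₂` and interior hinges `n₁`, `n₂`. When it opens, the inner
product of `n₁` and `n₂` decreases by some `x` and that of `e₁` and `e₂` increases by some `y`. Up
to positive constants of the slit, `x` is the opening of either end hinge and `y` that of either
interior hinge (`IsOpening.hinge_relations`). The Gram determinants of the two triangles on the
diagonal between the interior hinges yield, as all angles of the void are in `[0, π]`, a relation
`g * x = y * (A + S)`, where `g > 0` is constant, `A` is affine in `x` and `S` is the square root of
a product of two affine functions of `x` (`diagonal_relation`). Here `A + S` strictly decreases in
`x`, so `y / x` strictly increases with `x` (`IsSlit.exists_law`); also, `y = 0` implies `x = 0`.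

Round an interior panel there are four voids. Each of its four hinges is at the end of one slit and
in the interior of the next, in cyclic order. Hence the openings are all zero or all positive
(`iff_of_passesToEnds`). If two configurations have positive openings, then comparing them at
one hinge decides the comparison at all hinges. If one of them were more open, then the four ratios
`y / x` round an interior panel would all be larger for it; but their product, suitably normalised,
is one in both configurations (`eq_of_slitLaw`). So the openings agree, and since the sense of
rotation at the hinges is prescribed, the configurations agree (`IsCompatible.exists_eq_mul`). Hence
there is at most one configuration besides the undeployed one.
-/

noncomputable section

namespace Kirigami

/-! ### Triple products and rotations -/

theorem dotProduct_eq (u v : Vec3) : u ⬝ᵥ v = u 0 * v 0 + u 1 * v 1 + u 2 * v 2 := by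
  simp [dotProduct, Fin.sum_univ_three]

theorem triple_eq (p q r : Vec3) :
    triple p q r = p 0 * q 1 * r 2 - p 0 * q 2 * r 1 - p 1 * q 0 * r 2 + p 1 * q 2 * r 0
      + p 2 * q 0 * r 1 - p 2 * q 1 * r 0 := by
  simp [triple, Matrix.det_fin_three]

theorem triple_add_right (p q r r' : Vec3) :
    triple p q (r + r') = triple p q r + triple p q r' := by
  simp only [triple_eq, Pi.add_apply]; ring

theorem triple_smul_right (p q r : Vec3) (c : ℝ) : triple p q (c • r) = c * triple p q r := by
  simp only [triple_eq, Pi.smul_apply, smul_eq_mul]; ring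

theorem triple_self_right (p q : Vec3) : triple p q q = 0 := by
  simp only [triple_eq]; ring

theorem triple_rotate (p q r : Vec3) : triple p q r = triple q r p := by
  simp only [triple_eq]; ring

theorem triple_swap_right (p q r : Vec3) : triple p r q = -triple p q r := by
  simp only [triple_eq]; ring

theorem triple_swap_left (p q r : Vec3) : triple p q r = -triple q p r := by
  simp only [triple_eq]; ring

/-- The product of two triple products as a Gram determinant. -/
theorem triple_mul_triple (a b c d : Vec3) :
    triple a b c * triple a b d =
      a ⬝ᵥ a * (b ⬝ᵥ b * c ⬝ᵥ d - b ⬝ᵥ d * b ⬝ᵥ c) - a ⬝ᵥ b * (a ⬝ᵥ b * c ⬝ᵥ d - b ⬝ᵥ d * a ⬝ᵥ c)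
        + a ⬝ᵥ d * (a ⬝ᵥ b * b ⬝ᵥ c - b ⬝ᵥ b * a ⬝ᵥ c) := by
  simp only [triple_eq, dotProduct_eq]; ring

theorem triple_crossProduct (a b p u : Vec3) :
    triple a b (p ⨯₃ u) = a ⬝ᵥ p * b ⬝ᵥ u - a ⬝ᵥ u * b ⬝ᵥ p := by
  simp only [triple_eq, dotProduct_eq, cross_apply, Matrix.cons_val]; ring

/-- The derivative of the determinant at the identity is the trace. -/
theorem triple_trace (Q : Matrix (Fin 3) (Fin 3) ℝ) (a b c : Vec3) :
    triple (Q *ᵥ a) b c + triple a (Q *ᵥ b) c + triple a b (Q *ᵥ c) = Q.trace * triple a b c := by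
  simp only [triple_eq, Matrix.mulVec, dotProduct, Fin.sum_univ_three, Matrix.trace,
    Matrix.diag_apply]
  ring

theorem triple_mulVec (Q : Rotation) (p q r : Vec3) :
    triple (Q.1 *ᵥ p) (Q.1 *ᵥ q) (Q.1 *ᵥ r) = triple p q r := by
  have h : Matrix.of ![Q.1 *ᵥ p, Q.1 *ᵥ q, Q.1 *ᵥ r] = Matrix.of ![p, q, r] * Q.1ᵀ := by
    ext i j
    fin_cases i <;> simp [Matrix.mul_apply, Matrix.mulVec, dotProduct, mul_comm]
  have hd : Q.1.det = 1 := (Matrix.mem_specialOrthogonalGroup_iff.1 Q.2).2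
  rw [triple, h, Matrix.det_mul, Matrix.det_transpose, hd, mul_one, triple]

theorem Rotation.transpose_mul_self (Q : Rotation) : Q.1ᵀ * Q.1 = 1 := by
  have := (Matrix.mem_specialOrthogonalGroup_iff.1 Q.2).1
  exact (Matrix.mem_orthogonalGroup_iff' (Fin 3) ℝ).1 this

theorem dotProduct_mulVec_mulVec (Q : Rotation) (u v : Vec3) :
    (Q.1 *ᵥ u) ⬝ᵥ (Q.1 *ᵥ v) = u ⬝ᵥ v := by
  rw [Matrix.dotProduct_mulVec, ← Matrix.mulVec_transpose, Matrix.mulVec_mulVec,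
    Q.transpose_mul_self, Matrix.one_mulVec]

theorem Rotation.mulVec_inv_mul (A B : Rotation) (v : Vec3) :
    A.1 *ᵥ ((A⁻¹ * B).1 *ᵥ v) = B.1 *ᵥ v := by
  rw [Matrix.mulVec_mulVec]
  exact congrArg (fun Q : Rotation => Q.1 *ᵥ v) (mul_inv_cancel_left A B)

theorem Rotation.mulVec_inv_mulVec (A : Rotation) (v : Vec3) : A.1 *ᵥ (A⁻¹.1 *ᵥ v) = v := by
  simpa using A.mulVec_inv_mul 1 v

theorem Rotation.inv_mulVec_mulVec (A : Rotation) (v : Vec3) : A⁻¹.1 *ᵥ (A.1 *ᵥ v) = v := by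
  simpa using A⁻¹.mulVec_inv_mulVec v

theorem Rotation.inv_val (A : Rotation) : A⁻¹.1 = A.1ᵀ := rfl

theorem Rotation.inv_mul_mulVec_eq_self {A B : Rotation} {p : Vec3}
    (h : A.1 *ᵥ p = B.1 *ᵥ p) : (A⁻¹ * B).1 *ᵥ p = p := by
  have := congrArg (A⁻¹.1 *ᵥ ·) (A.mulVec_inv_mul B p)
  simpa only [Rotation.inv_mulVec_mulVec, ← h] using this

theorem dotProduct_mulVec_relative (A B : Rotation) (u v : Vec3) :
    (A.1 *ᵥ u) ⬝ᵥ (B.1 *ᵥ v) = u ⬝ᵥ ((A⁻¹ * B).1 *ᵥ v) := by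
  rw [← A.mulVec_inv_mul B v, dotProduct_mulVec_mulVec]

theorem triple_mulVec_relative (A B : Rotation) (p q r : Vec3) :
    triple (A.1 *ᵥ p) (A.1 *ᵥ q) (B.1 *ᵥ r) = triple p q ((A⁻¹ * B).1 *ᵥ r) := by
  rw [← A.mulVec_inv_mul B r, triple_mulVec]

/-! ### The opening of a hinge -/

/-- The opening `sin² (ω / 2)` of a hinge between two panels which are moved by the rotations `A`
and `B`; here `ω` is the angle of the relative rotation `A⁻¹ * B`, whose trace is `1 + 2 cos ω`. -/
def hingeOpening (A B : Rotation) : ℝ := (3 - (A⁻¹ * B).1.trace) / 4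

theorem hingeOpening_comm (A B : Rotation) : hingeOpening A B = hingeOpening B A := by
  have h : B⁻¹ * A = (A⁻¹ * B)⁻¹ := by rw [mul_inv_rev, inv_inv]
  rw [hingeOpening, hingeOpening, h, Rotation.inv_val, Matrix.trace_transpose]

theorem hingeOpening_self (A : Rotation) : hingeOpening A A = 0 := by
  rw [hingeOpening, inv_mul_cancel, OneMemClass.coe_one, Matrix.trace_one]
  norm_num

/-- The squared Frobenius norm of `Q - 1`. -/
theorem Rotation.trace_sub_one_sq (Q : Rotation) :
    ((Q.1 - 1)ᵀ * (Q.1 - 1)).trace = 2 * (3 - Q.1.trace) := by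
  have h : (Q.1 - 1)ᵀ * (Q.1 - 1) = 1 + 1 - Q.1ᵀ - Q.1 := by
    rw [Matrix.transpose_sub, Matrix.transpose_one, sub_mul, mul_sub, mul_sub,
      Q.transpose_mul_self]
    simp only [mul_one, one_mul]
    abel
  rw [h]
  simp only [Matrix.trace_sub, Matrix.trace_add, Matrix.trace_transpose, Matrix.trace_one,
    Fintype.card_fin]
  norm_num
  ring

theorem hingeOpening_nonneg (A B : Rotation) : 0 ≤ hingeOpening A B := by
  have h := Matrix.PosSemidef.trace_nonneg
    (Matrix.posSemidef_conjTranspose_mul_self ((A⁻¹ * B).1 - 1))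
  rw [Matrix.conjTranspose_eq_transpose_of_trivial, Rotation.trace_sub_one_sq] at h
  rw [hingeOpening]
  linarith

theorem eq_of_hingeOpening_eq_zero {A B : Rotation} (h : hingeOpening A B = 0) : A = B := by
  have h0 : (((A⁻¹ * B).1 - 1)ᴴ * ((A⁻¹ * B).1 - 1)).trace = 0 := by
    rw [Matrix.conjTranspose_eq_transpose_of_trivial, Rotation.trace_sub_one_sq]
    rw [hingeOpening] at h
    linarith
  rw [Matrix.trace_conjTranspose_mul_self_eq_zero_iff, sub_eq_zero] at h0
  exact inv_mul_eq_one.1 (Subtype.ext h0)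

/-- How far a point `u` of one panel moves, relative to a second panel which is hinged to the first
at `p`. -/
theorem dotProduct_self_sub_eq_hingeOpening {A B : Rotation} {p : Vec3}
    (h : A.1 *ᵥ p = B.1 *ᵥ p) (u : Vec3) :
    p ⬝ᵥ p * (u ⬝ᵥ u - (A.1 *ᵥ u) ⬝ᵥ (B.1 *ᵥ u)) =
      2 * hingeOpening A B * (p ⬝ᵥ p * u ⬝ᵥ u - (p ⬝ᵥ u) ^ 2) := by
  have hp := Rotation.inv_mul_mulVec_eq_self h
  rw [dotProduct_mulVec_relative]
  have hQ : hingeOpening A B = (3 - (A⁻¹ * B).1.trace) / 4 := rfl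
  set Q : Rotation := A⁻¹ * B
  have hpu : p ⬝ᵥ (Q.1 *ᵥ u) = p ⬝ᵥ u := by
    nth_rewrite 1 [← hp]
    exact dotProduct_mulVec_mulVec Q p u
  have hp' : Q⁻¹.1 *ᵥ p = p := by
    nth_rewrite 1 [← hp]
    exact Q.inv_mulVec_mulVec p
  have hpu' : p ⬝ᵥ (Q⁻¹.1 *ᵥ u) = p ⬝ᵥ u := by
    nth_rewrite 1 [← hp']
    exact dotProduct_mulVec_mulVec Q⁻¹ p u
  have huu : (Q⁻¹.1 *ᵥ u) ⬝ᵥ u = u ⬝ᵥ (Q.1 *ᵥ u) := by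
    rw [← dotProduct_mulVec_mulVec Q, Q.mulVec_inv_mulVec]
  have h3 : triple p u (Q.1 *ᵥ (p ⨯₃ u)) = triple p (Q⁻¹.1 *ᵥ u) (p ⨯₃ u) := by
    rw [← triple_mulVec Q p (Q⁻¹.1 *ᵥ u), Q.mulVec_inv_mulVec, hp]
  have ht := triple_trace Q.1 p u (p ⨯₃ u)
  rw [h3, hp] at ht
  simp only [triple_crossProduct, huu, dotProduct_comm _ p, hpu, hpu'] at ht
  rw [dotProduct_comm (Q.1 *ᵥ u) u] at ht
  rw [hQ]
  linear_combination -ht / 2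

theorem eq_zero_of_triple_eq_zero {p u d : Vec3} (hpu : 0 < p ⬝ᵥ p * u ⬝ᵥ u - (p ⬝ᵥ u) ^ 2)
    (hp : p ⬝ᵥ d = 0) (hu : u ⬝ᵥ d = 0) (h : triple p u d = 0) : d = 0 := by
  have h1 := triple_mul_triple p u d d
  rw [h, hp, hu] at h1
  have h2 : (p ⬝ᵥ p * u ⬝ᵥ u - (p ⬝ᵥ u) ^ 2) * d ⬝ᵥ d = 0 := by linear_combination -h1
  exact dotProduct_self_eq_zero.1 ((mul_eq_zero.1 h2).resolve_left hpu.ne')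

/-- The relative rotation at a hinge `p` is determined by the opening of the hinge and by the sense
in which the hinge opens. -/
theorem relative_eq_of_hingeOpening_eq {A B A' B' : Rotation} {p u : Vec3}
    (hpu : 0 < p ⬝ᵥ p * u ⬝ᵥ u - (p ⬝ᵥ u) ^ 2) (h : A.1 *ᵥ p = B.1 *ᵥ p)
    (h' : A'.1 *ᵥ p = B'.1 *ᵥ p) (ho : hingeOpening A B = hingeOpening A' B')
    (hs : 0 ≤ triple p u ((A⁻¹ * B).1 *ᵥ u) * triple p u ((A'⁻¹ * B').1 *ᵥ u)) :
    A⁻¹ * B = A'⁻¹ * B' := by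
  have hpp : 0 < p ⬝ᵥ p := by
    by_contra hn
    have h0 : p = 0 := by
      apply dotProduct_self_eq_zero.1
      exact le_antisymm (not_lt.1 hn) (by simpa using dotProduct_star_self_nonneg p)
    simp [h0] at hpu
  have hp := Rotation.inv_mul_mulVec_eq_self h
  have hp' := Rotation.inv_mul_mulVec_eq_self h'
  have e := dotProduct_self_sub_eq_hingeOpening h u
  have e' := dotProduct_self_sub_eq_hingeOpening h' u
  rw [dotProduct_mulVec_relative] at e e'
  rw [← ho] at e'
  set Q : Rotation := A⁻¹ * B
  set Q' : Rotation := A'⁻¹ * B'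
  have hu : u ⬝ᵥ (Q.1 *ᵥ u) = u ⬝ᵥ (Q'.1 *ᵥ u) :=
    mul_left_cancel₀ hpp.ne' (by linear_combination e' - e)
  have key : ∀ S : Rotation, S.1 *ᵥ p = p → p ⬝ᵥ (S.1 *ᵥ u) = p ⬝ᵥ u := fun S hS => by
    nth_rewrite 1 [← hS]
    exact dotProduct_mulVec_mulVec S p u
  have hsq : triple p u (Q.1 *ᵥ u) ^ 2 = triple p u (Q'.1 *ᵥ u) ^ 2 := by
    rw [sq, sq, triple_mul_triple, triple_mul_triple, key Q hp, key Q' hp', hu,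
      dotProduct_mulVec_mulVec, dotProduct_mulVec_mulVec]
  have htr : triple p u (Q.1 *ᵥ u) = triple p u (Q'.1 *ᵥ u) := by
    rcases sq_eq_sq_iff_eq_or_eq_neg.1 hsq with h1 | h1
    · exact h1
    · rw [h1] at hs ⊢
      have h0 : triple p u (Q'.1 *ᵥ u) = 0 := by nlinarith
      rw [h0, neg_zero]
  have hQu : Q.1 *ᵥ u = Q'.1 *ᵥ u := by
    rw [← sub_eq_zero]
    apply eq_zero_of_triple_eq_zero hpu
    · rw [dotProduct_sub, key Q hp, key Q' hp', sub_self]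
    · rw [dotProduct_sub, hu, sub_self]
    · rw [sub_eq_add_neg, triple_add_right, htr, ← neg_one_smul ℝ, triple_smul_right]
      ring
  -- `Q` and `Q'` agree at `p` and `u`, so the opening of `Q⁻¹ * Q'` is zero.
  have h0 := dotProduct_self_sub_eq_hingeOpening (hp.trans hp'.symm) u
  rw [hQu, dotProduct_mulVec_mulVec, sub_self, mul_zero] at h0
  apply eq_of_hingeOpening_eq_zero
  have := (mul_eq_zero.1 h0.symm).resolve_right hpu.ne'
  linarith

/-! ### Slits and their openings -/

/-- The compact state of a slit on the sphere of squared radius `ρ`: the hinges `n₁`, `n₂` are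
interior points of the minor arc between the hinges `e₂` and `e₁`. -/
structure IsSlit (ρ : ℝ) (n₁ e₁ n₂ e₂ : Vec3) : Prop where
  pos : 0 < ρ
  norm_e₁ : e₁ ⬝ᵥ e₁ = ρ
  norm_e₂ : e₂ ⬝ᵥ e₂ = ρ
  norm_n₁ : n₁ ⬝ᵥ n₁ = ρ
  norm_n₂ : n₂ ⬝ᵥ n₂ = ρ
  arc₁ : OnMinorArc e₂ e₁ n₁
  arc₂ : OnMinorArc e₂ e₁ n₂

/-- Four panels, moved by `A`, `B`, `C`, `D` and joined in cyclic order at the hinges `n₁`, `e₁`,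
`n₂`, `e₂` of a slit, open the slit into a weakly convex void. -/
structure IsOpening (n₁ e₁ n₂ e₂ : Vec3) (A B C D : Rotation) : Prop where
  hinge_n₁ : A.1 *ᵥ n₁ = B.1 *ᵥ n₁
  hinge_e₁ : B.1 *ᵥ e₁ = C.1 *ᵥ e₁
  hinge_n₂ : C.1 *ᵥ n₂ = D.1 *ᵥ n₂
  hinge_e₂ : D.1 *ᵥ e₂ = A.1 *ᵥ e₂
  convex : WeaklyConvex (A.1 *ᵥ n₁) (B.1 *ᵥ e₁) (C.1 *ᵥ n₂) (D.1 *ᵥ e₂)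

theorem OnMinorArc.symm {p q x : Vec3} (h : OnMinorArc p q x) : OnMinorArc q p x := by
  obtain ⟨hl, s, t, hs, ht, rfl⟩ := h
  refine ⟨?_, t, s, ht, hs, add_comm _ _⟩
  rw [LinearIndependent.pair_iff] at hl ⊢
  intro a b hab
  exact (hl b a (by rw [add_comm, hab])).symm

theorem IsSlit.symm {ρ : ℝ} {n₁ e₁ n₂ e₂ : Vec3} (h : IsSlit ρ n₁ e₁ n₂ e₂) :
    IsSlit ρ n₂ e₂ n₁ e₁ :=
  ⟨h.pos, h.norm_e₂, h.norm_e₁, h.norm_n₂, h.norm_n₁, h.arc₂.symm, h.arc₁.symm⟩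

theorem IsOpening.symm {n₁ e₁ n₂ e₂ : Vec3} {A B C D : Rotation}
    (h : IsOpening n₁ e₁ n₂ e₂ A B C D) : IsOpening n₂ e₂ n₁ e₁ C D A B := by
  obtain ⟨h1, h2, h3, h4, c1, c2, c3, c4⟩ := h
  exact ⟨h3, h4, h1, h2, c3, c4, c1, c2⟩

theorem sq_dotProduct_lt {ρ : ℝ} {p q : Vec3} (hρ : 0 < ρ) (hp : p ⬝ᵥ p = ρ) (hq : q ⬝ᵥ q = ρ)
    (h : LinearIndependent ℝ ![p, q]) : (p ⬝ᵥ q) ^ 2 < ρ ^ 2 := by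
  have e : ((p ⬝ᵥ q) • p + (-ρ) • q) ⬝ᵥ ((p ⬝ᵥ q) • p + (-ρ) • q) = ρ * (ρ ^ 2 - (p ⬝ᵥ q) ^ 2) := by
    simp only [add_dotProduct, dotProduct_add, smul_dotProduct, dotProduct_smul, hp, hq,
      dotProduct_comm q p, smul_eq_mul]
    ring
  have h0 : 0 ≤ ρ * (ρ ^ 2 - (p ⬝ᵥ q) ^ 2) := by
    rw [← e]
    simpa using dotProduct_star_self_nonneg ((p ⬝ᵥ q) • p + (-ρ) • q)
  have h1 : ρ * (ρ ^ 2 - (p ⬝ᵥ q) ^ 2) ≠ 0 := by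
    intro hz
    rw [← e, dotProduct_self_eq_zero] at hz
    have := ((LinearIndependent.pair_iff.1 h) _ _ hz).2
    linarith
  have := pos_of_mul_pos_right (lt_of_le_of_ne h0 (Ne.symm h1)) hρ.le
  linarith

/-- The deployment relation between the diagonals of a void. Write `x` for the decrease of the
inner product of the interior hinges, from `V₀` to `V`, and `y` for the increase of that of the end
hinges, from `U₀` to `W`. The triple products `p`, `q` are those of the two triangles into which the
void is cut by the diagonal between the interior hinges; their squares and their product are Gram
determinants. -/
theorem diagonal_relation {ρ U₀ V₀ l₁ l₂ r₁ r₂ V W p q : ℝ}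
    (hp : 0 ≤ p) (hq : 0 ≤ q) (hV : V ^ 2 < ρ ^ 2) (hx : V < V₀)
    (hL : ρ ^ 3 + 2 * V₀ * l₁ * l₂ - ρ * (V₀ ^ 2 + l₁ ^ 2 + l₂ ^ 2) = 0)
    (hR : ρ ^ 3 + 2 * V₀ * r₁ * r₂ - ρ * (V₀ ^ 2 + r₁ ^ 2 + r₂ ^ 2) = 0)
    (hLR : U₀ * (ρ ^ 2 - V₀ ^ 2) - ρ * (l₁ * r₁ + l₂ * r₂) + (l₁ * r₂ + l₂ * r₁) * V₀ = 0)
    (hA : ((l₁ * r₂ + l₂ * r₁) - U₀ * (V₀ + V)) ^ 2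
      - (ρ * (V + V₀) - 2 * l₁ * l₂) * (ρ * (V + V₀) - 2 * r₁ * r₂)
      = (ρ ^ 2 - V ^ 2) * (ρ ^ 2 - U₀ ^ 2))
    (hpp : p ^ 2 = ρ ^ 3 + 2 * V * l₁ * l₂ - ρ * (V ^ 2 + l₁ ^ 2 + l₂ ^ 2))
    (hqq : q ^ 2 = ρ ^ 3 + 2 * V * r₁ * r₂ - ρ * (V ^ 2 + r₁ ^ 2 + r₂ ^ 2))
    (hpq : -(p * q) = W * (ρ ^ 2 - V ^ 2) - ρ * (l₁ * r₁ + l₂ * r₂) + (l₁ * r₂ + l₂ * r₁) * V) :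
    0 ≤ ρ * (V + V₀) - 2 * l₁ * l₂ ∧ 0 ≤ ρ * (V + V₀) - 2 * r₁ * r₂ ∧
      (ρ ^ 2 - U₀ ^ 2) * (V₀ - V) = (W - U₀) * ((l₁ * r₂ + l₂ * r₁) - U₀ * (V₀ + V) +
        √((ρ * (V + V₀) - 2 * l₁ * l₂) * (ρ * (V + V₀) - 2 * r₁ * r₂))) := by
  have hx' : 0 < V₀ - V := sub_pos.2 hx
  have h1 : p ^ 2 = (V₀ - V) * (ρ * (V + V₀) - 2 * l₁ * l₂) := by linear_combination hpp + hL
  have h2 : q ^ 2 = (V₀ - V) * (ρ * (V + V₀) - 2 * r₁ * r₂) := by linear_combination hqq + hR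
  have ha : 0 ≤ ρ * (V + V₀) - 2 * l₁ * l₂ :=
    nonneg_of_mul_nonneg_right (h1 ▸ sq_nonneg p) hx'
  have hb : 0 ≤ ρ * (V + V₀) - 2 * r₁ * r₂ :=
    nonneg_of_mul_nonneg_right (h2 ▸ sq_nonneg q) hx'
  refine ⟨ha, hb, ?_⟩
  have hS : p * q = (V₀ - V) *
      √((ρ * (V + V₀) - 2 * l₁ * l₂) * (ρ * (V + V₀) - 2 * r₁ * r₂)) := by
    have h3 : p * q = √((p * q) ^ 2) := (Real.sqrt_sq (mul_nonneg hp hq)).symm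
    rw [h3, mul_pow, h1, h2, mul_mul_mul_comm, ← sq, Real.sqrt_mul (sq_nonneg _),
      Real.sqrt_sq hx'.le]
  have hSS := Real.sq_sqrt (mul_nonneg ha hb)
  set S := √((ρ * (V + V₀) - 2 * l₁ * l₂) * (ρ * (V + V₀) - 2 * r₁ * r₂))
  have hy : (W - U₀) * (ρ ^ 2 - V ^ 2) =
      (V₀ - V) * ((l₁ * r₂ + l₂ * r₁) - U₀ * (V₀ + V) - S) := by
    linear_combination -hpq - hS - hLR
  apply mul_left_cancel₀ (sub_pos.2 hV).ne'
  linear_combination -(V₀ - V) * hA + (V₀ - V) * hSS -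
    ((l₁ * r₂ + l₂ * r₁) - U₀ * (V₀ + V) + S) * hy

theorem add_le_sqrt_mul {a b d : ℝ} (ha : 0 ≤ a) (hb : 0 ≤ b) (hd : 0 ≤ d) :
    √(a * b) + d ≤ √((a + d) * (b + d)) := by
  apply Real.le_sqrt_of_sq_le
  have h1 := Real.sq_sqrt (mul_nonneg ha hb)
  have h2 : 2 * √(a * b) ≤ a + b := by
    rw [Real.sqrt_mul ha]
    nlinarith [sq_nonneg (√a - √b), Real.sq_sqrt ha, Real.sq_sqrt hb]
  nlinarith

/-- The law of deployment of a slit: pairs `(x, y)`, `(x', y')`, which measure two openings of it,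
at an end hinge (`x`) and at an interior hinge (`y`), satisfy that `y / x` strictly increases with
`x`. -/
structure DeploymentLaw (x y x' y' : ℝ) : Prop where
  lt : x < x' → y * x' < y' * x
  gt : x' < x → y' * x < y * x'
  eq : x = x' → y = y'

theorem DeploymentLaw.smul {x y x' y' a b : ℝ} (h : DeploymentLaw (a * x) (b * y) (a * x') (b * y'))
    (ha : 0 < a) (hb : 0 < b) : DeploymentLaw x y x' y' := by
  have hab := mul_pos ha hb
  refine ⟨fun hx => ?_, fun hx => ?_, fun hx => ?_⟩
  · have := h.lt (mul_lt_mul_of_pos_left hx ha)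
    exact lt_of_mul_lt_mul_left (by linarith : a * b * _ < a * b * _) hab.le
  · have := h.gt (mul_lt_mul_of_pos_left hx ha)
    exact lt_of_mul_lt_mul_left (by linarith : a * b * _ < a * b * _) hab.le
  · exact mul_left_cancel₀ hb.ne' (h.eq (by rw [hx]))

/-- In `g * x = y * (A + S)` the factor `A + S` strictly decreases as `x` increases: as a function of
`V = V₀ - x`, the square root `S` increases with slope at least `ρ`, and the slope of `A` is
`-U₀ > -ρ`. -/
theorem mul_lt_mul_of_diagonal_relation {ρ U₀ F V₀ a b V V' y y' : ℝ} (hρ : 0 < ρ)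
    (hU : U₀ ^ 2 < ρ ^ 2) (hx : V < V₀) (hy : 0 ≤ y) (hy' : 0 ≤ y')
    (ha : 0 ≤ ρ * (V' + V₀) - a) (hb : 0 ≤ ρ * (V' + V₀) - b)
    (h : (ρ ^ 2 - U₀ ^ 2) * (V₀ - V) = y * (F - U₀ * (V₀ + V) +
      √((ρ * (V + V₀) - a) * (ρ * (V + V₀) - b))))
    (h' : (ρ ^ 2 - U₀ ^ 2) * (V₀ - V') = y' * (F - U₀ * (V₀ + V') +
      √((ρ * (V' + V₀) - a) * (ρ * (V' + V₀) - b))))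
    (hlt : V₀ - V < V₀ - V') : y * (V₀ - V') < y' * (V₀ - V) := by
  have hg : 0 < ρ ^ 2 - U₀ ^ 2 := sub_pos.2 hU
  have hd : 0 < V - V' := by linarith
  have hS := add_le_sqrt_mul ha hb (mul_pos hρ hd).le
  rw [show ρ * (V' + V₀) - a + ρ * (V - V') = ρ * (V + V₀) - a by ring,
    show ρ * (V' + V₀) - b + ρ * (V - V') = ρ * (V + V₀) - b by ring] at hS
  have hUρ : U₀ < ρ := (abs_lt_of_sq_lt_sq' hU hρ.le).2
  have hpos : 0 < y * (F - U₀ * (V₀ + V) + √((ρ * (V + V₀) - a) * (ρ * (V + V₀) - b))) :=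
    h ▸ mul_pos hg (by linarith)
  have hpos' : 0 < y' * (F - U₀ * (V₀ + V') + √((ρ * (V' + V₀) - a) * (ρ * (V' + V₀) - b))) :=
    h' ▸ mul_pos hg (by linarith)
  have hyp : 0 < y := lt_of_le_of_ne hy fun h0 => by simp [← h0] at hpos
  have hyp' : 0 < y' := lt_of_le_of_ne hy' fun h0 => by simp [← h0] at hpos'
  have hK : F - U₀ * (V₀ + V') + √((ρ * (V' + V₀) - a) * (ρ * (V' + V₀) - b)) <
      F - U₀ * (V₀ + V) + √((ρ * (V + V₀) - a) * (ρ * (V + V₀) - b)) := by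
    nlinarith [mul_lt_mul_of_pos_right hUρ hd]
  have := mul_lt_mul_of_pos_left hK (mul_pos hyp hyp')
  refine lt_of_mul_lt_mul_left ?_ hg.le
  linear_combination this + y * h' - y' * h

/-- How the inner product of two points `u`, `v` of hinged panels changes when `u`, `v` and the hinge
`p` lie on a great circle in the compact state. -/
theorem dotProduct_sub_eq_hingeOpening {X Y : Rotation} {p u v : Vec3} {a b c : ℝ}
    (h : X.1 *ᵥ p = Y.1 *ᵥ p) (hv : c • v = a • p + b • u) :
    p ⬝ᵥ p * (c * (u ⬝ᵥ v - (X.1 *ᵥ u) ⬝ᵥ (Y.1 *ᵥ v))) =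
      2 * b * hingeOpening X Y * (p ⬝ᵥ p * u ⬝ᵥ u - (p ⬝ᵥ u) ^ 2) := by
  have h1 : c * (u ⬝ᵥ v) = a * (u ⬝ᵥ p) + b * (u ⬝ᵥ u) := by
    simpa using congrArg (u ⬝ᵥ ·) hv
  have h2 : c * ((X.1 *ᵥ u) ⬝ᵥ (Y.1 *ᵥ v)) =
      a * (u ⬝ᵥ p) + b * ((X.1 *ᵥ u) ⬝ᵥ (Y.1 *ᵥ u)) := by
    have := congrArg (fun w => (X.1 *ᵥ u) ⬝ᵥ (Y.1 *ᵥ w)) hv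
    simp only [Matrix.mulVec_add, Matrix.mulVec_smul, dotProduct_add, dotProduct_smul,
      smul_eq_mul] at this
    rw [this, ← h, dotProduct_mulVec_mulVec]
  have h3 := dotProduct_self_sub_eq_hingeOpening h u
  linear_combination (p ⬝ᵥ p) * (h1 - h2) + b * h3

/-- The change of either diagonal of a void is proportional to the openings of the two hinges which
the diagonal does not meet. -/
theorem IsOpening.hinge_relations {ρ : ℝ} {n₁ e₁ n₂ e₂ : Vec3} {A B C D : Rotation}
    {s t s' t' : ℝ} (hS : IsSlit ρ n₁ e₁ n₂ e₂) (h : IsOpening n₁ e₁ n₂ e₂ A B C D)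
    (hs : 0 < s) (ht : 0 < t) (hs' : 0 < s')
    (h₁ : n₁ = s • e₂ + t • e₁) (h₂ : n₂ = s' • e₂ + t' • e₁) :
    ρ * (n₁ ⬝ᵥ n₂ - (A.1 *ᵥ n₁) ⬝ᵥ (C.1 *ᵥ n₂)) =
        2 * t * t' * (ρ ^ 2 - (e₂ ⬝ᵥ e₁) ^ 2) * hingeOpening D A ∧
      ρ * (n₁ ⬝ᵥ n₂ - (A.1 *ᵥ n₁) ⬝ᵥ (C.1 *ᵥ n₂)) =
        2 * s * s' * (ρ ^ 2 - (e₂ ⬝ᵥ e₁) ^ 2) * hingeOpening B C ∧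
      ρ * ((D.1 *ᵥ e₂) ⬝ᵥ (B.1 *ᵥ e₁) - e₂ ⬝ᵥ e₁) =
        2 * s * t * (ρ ^ 2 - (e₂ ⬝ᵥ e₁) ^ 2) * hingeOpening A B ∧
      ρ * ((D.1 *ᵥ e₂) ⬝ᵥ (B.1 *ᵥ e₁) - e₂ ⬝ᵥ e₁) =
        2 * s' * t' * (ρ ^ 2 - (e₂ ⬝ᵥ e₁) ^ 2) * hingeOpening C D := by
  have hle₁ : e₂ ⬝ᵥ n₁ = s * ρ + t * e₂ ⬝ᵥ e₁ := by simp [h₁, hS.norm_e₂]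
  have hre₁ : e₁ ⬝ᵥ n₁ = s * e₂ ⬝ᵥ e₁ + t * ρ := by
    simp [h₁, hS.norm_e₁, dotProduct_comm e₁ e₂]
  have hre₂ : e₁ ⬝ᵥ n₂ = s' * e₂ ⬝ᵥ e₁ + t' * ρ := by
    simp [h₂, hS.norm_e₁, dotProduct_comm e₁ e₂]
  have hle₂ : e₂ ⬝ᵥ n₂ = s' * ρ + t' * e₂ ⬝ᵥ e₁ := by simp [h₂, hS.norm_e₂]
  have hn₁ : s * e₂ ⬝ᵥ n₁ + t * e₁ ⬝ᵥ n₁ = ρ := by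
    rw [← hS.norm_n₁]; nth_rewrite 3 [h₁]; simp
  have hn₂ : s' * e₂ ⬝ᵥ n₂ + t' * e₁ ⬝ᵥ n₂ = ρ := by
    rw [← hS.norm_n₂]; nth_rewrite 3 [h₂]; simp
  have k1 := dotProduct_sub_eq_hingeOpening (u := n₁) (v := n₂) (a := s' * t - s * t') (b := t')
    (c := t) h.hinge_e₂.symm (by rw [h₁, h₂]; module)
  have k2 := dotProduct_sub_eq_hingeOpening (u := n₁) (v := n₂) (a := s * t' - s' * t) (b := s')
    (c := s) h.hinge_e₁ (by rw [h₁, h₂]; module)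
  have k3 := dotProduct_sub_eq_hingeOpening (u := e₂) (v := e₁) (a := 1) (b := -s)
    (c := t) h.hinge_n₁ (by rw [h₁]; module)
  have k4 := dotProduct_sub_eq_hingeOpening (u := e₁) (v := e₂) (a := 1) (b := -t')
    (c := s') h.hinge_n₂ (by rw [h₂]; module)
  rw [← h.hinge_n₂, hingeOpening_comm A D, hS.norm_e₂, hS.norm_n₁, hle₁] at k1
  rw [← h.hinge_n₁, hS.norm_e₁, hS.norm_n₁, hre₁] at k2
  rw [← h.hinge_e₂, hS.norm_n₁, hS.norm_e₂, dotProduct_comm n₁ e₂, hle₁] at k3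
  rw [← h.hinge_e₁, hS.norm_n₂, hS.norm_e₁, dotProduct_comm n₂ e₁, hre₂, dotProduct_comm e₁ e₂,
    dotProduct_comm (B.1 *ᵥ e₁)] at k4
  rw [hle₁, hre₁] at hn₁
  rw [hle₂, hre₂] at hn₂
  refine ⟨mul_left_cancel₀ ht.ne' ?_, mul_left_cancel₀ hs.ne' ?_, mul_left_cancel₀ ht.ne' ?_,
    mul_left_cancel₀ hs'.ne' ?_⟩
  · linear_combination k1 - 2 * t' * hingeOpening D A * ρ * hn₁
  · linear_combination k2 - 2 * s' * hingeOpening B C * ρ * hn₁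
  · linear_combination -k3 - 2 * s * hingeOpening A B * ρ * hn₁
  · linear_combination -k4 - 2 * t' * hingeOpening C D * ρ * hn₂

theorem IsSlit.exists_coeff {ρ : ℝ} {n₁ e₁ n₂ e₂ : Vec3} (hS : IsSlit ρ n₁ e₁ n₂ e₂) :
    (e₂ ⬝ᵥ e₁) ^ 2 < ρ ^ 2 ∧ ∃ s t s' t' : ℝ, 0 < s ∧ 0 < t ∧ 0 < s' ∧ 0 < t' ∧
      n₁ = s • e₂ + t • e₁ ∧ n₂ = s' • e₂ + t' • e₁ := by
  obtain ⟨hl, s, t, hs, ht, h₁⟩ := hS.arc₁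
  obtain ⟨-, s', t', hs', ht', h₂⟩ := hS.arc₂
  exact ⟨sq_dotProduct_lt hS.pos hS.norm_e₂ hS.norm_e₁ hl, s, t, s', t', hs, ht, hs', ht', h₁, h₂⟩

/-- In an open void the interior hinges are neither equal nor antipodal. -/
theorem IsOpening.sq_dotProduct_lt {ρ : ℝ} {n₁ e₁ n₂ e₂ : Vec3} {A B C D : Rotation}
    (hS : IsSlit ρ n₁ e₁ n₂ e₂) (h : IsOpening n₁ e₁ n₂ e₂ A B C D)
    (hx : (A.1 *ᵥ n₁) ⬝ᵥ (C.1 *ᵥ n₂) < n₁ ⬝ᵥ n₂) :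
    ((A.1 *ᵥ n₁) ⬝ᵥ (C.1 *ᵥ n₂)) ^ 2 < ρ ^ 2 := by
  have hρ := hS.pos
  have hsum : ∀ u v : Vec3, u ⬝ᵥ u = ρ → v ⬝ᵥ v = ρ →
      (u + v) ⬝ᵥ (u + v) = 2 * (ρ + u ⬝ᵥ v) := fun u v hu hv => by
    simp only [add_dotProduct, dotProduct_add, hu, hv, dotProduct_comm v u]; ring
  have hle : ∀ u v : Vec3, u ⬝ᵥ u = ρ → v ⬝ᵥ v = ρ → -ρ ≤ u ⬝ᵥ v := fun u v hu hv => by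
    have := hsum u v hu hv
    have h0 : 0 ≤ (u + v) ⬝ᵥ (u + v) := by simpa using dotProduct_star_self_nonneg (u + v)
    linarith
  have hA : (A.1 *ᵥ n₁) ⬝ᵥ (A.1 *ᵥ n₁) = ρ := by rw [dotProduct_mulVec_mulVec, hS.norm_n₁]
  have hC : (C.1 *ᵥ n₂) ⬝ᵥ (C.1 *ᵥ n₂) = ρ := by rw [dotProduct_mulVec_mulVec, hS.norm_n₂]
  have h1 : n₁ ⬝ᵥ n₂ ≤ ρ := by
    have := hle n₁ (-n₂) hS.norm_n₁ (by simpa using hS.norm_n₂)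
    rw [dotProduct_neg] at this
    linarith
  refine sq_lt_sq' (lt_of_le_of_ne (hle _ _ hA hC) fun he => ?_) (hx.trans_le h1)
  -- If the interior hinges were antipodal, the perimeter of the void would be that of a great
  -- circle, although the slit is shorter than half a great circle.
  have h0 : A.1 *ᵥ n₁ + C.1 *ᵥ n₂ = 0 := by
    rw [← dotProduct_self_eq_zero, hsum _ _ hA hC, ← he]; ring
  obtain ⟨hU, s, t, s', t', hs, ht, hs', ht', h₁, h₂⟩ := hS.exists_coeff
  have e1 : e₂ ⬝ᵥ n₁ + e₂ ⬝ᵥ n₂ = 0 := by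
    have := congrArg ((D.1 *ᵥ e₂) ⬝ᵥ ·) h0
    simp only [dotProduct_add, dotProduct_zero] at this
    rwa [h.hinge_n₂, dotProduct_mulVec_mulVec, h.hinge_e₂, dotProduct_mulVec_mulVec] at this
  have e2 : e₁ ⬝ᵥ n₁ + e₁ ⬝ᵥ n₂ = 0 := by
    have := congrArg ((B.1 *ᵥ e₁) ⬝ᵥ ·) h0
    simp only [dotProduct_add, dotProduct_zero] at this
    rwa [h.hinge_n₁, dotProduct_mulVec_mulVec, h.hinge_e₁, dotProduct_mulVec_mulVec] at this
  simp only [h₁, h₂, dotProduct_add, dotProduct_smul, smul_eq_mul, hS.norm_e₁, hS.norm_e₂,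
    dotProduct_comm e₁ e₂] at e1 e2
  have hpos : 0 < (s + s' + t + t') * (ρ + e₂ ⬝ᵥ e₁) :=
    mul_pos (by positivity) (by linarith [(abs_lt_of_sq_lt_sq' hU hρ.le).1])
  linarith

/-- `diagonal_relation` for an opening of a slit. -/
theorem IsOpening.diagonal_relation {ρ : ℝ} {n₁ e₁ n₂ e₂ : Vec3} {A B C D : Rotation}
    (hS : IsSlit ρ n₁ e₁ n₂ e₂) (h : IsOpening n₁ e₁ n₂ e₂ A B C D)
    {V W : ℝ} (hV : V = (A.1 *ᵥ n₁) ⬝ᵥ (C.1 *ᵥ n₂)) (hW : W = (D.1 *ᵥ e₂) ⬝ᵥ (B.1 *ᵥ e₁))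
    (hx : V < n₁ ⬝ᵥ n₂) :
    0 ≤ ρ * (V + n₁ ⬝ᵥ n₂) - 2 * e₂ ⬝ᵥ n₁ * e₂ ⬝ᵥ n₂ ∧
      0 ≤ ρ * (V + n₁ ⬝ᵥ n₂) - 2 * e₁ ⬝ᵥ n₁ * e₁ ⬝ᵥ n₂ ∧
      (ρ ^ 2 - (e₂ ⬝ᵥ e₁) ^ 2) * (n₁ ⬝ᵥ n₂ - V) = (W - e₂ ⬝ᵥ e₁) *
        ((e₂ ⬝ᵥ n₁ * e₁ ⬝ᵥ n₂ + e₂ ⬝ᵥ n₂ * e₁ ⬝ᵥ n₁) - e₂ ⬝ᵥ e₁ * (n₁ ⬝ᵥ n₂ + V) +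
          √((ρ * (V + n₁ ⬝ᵥ n₂) - 2 * e₂ ⬝ᵥ n₁ * e₂ ⬝ᵥ n₂) *
            (ρ * (V + n₁ ⬝ᵥ n₂) - 2 * e₁ ⬝ᵥ n₁ * e₁ ⬝ᵥ n₂))) := by
  have hVlt : V ^ 2 < ρ ^ 2 := hV ▸ h.sq_dotProduct_lt hS (hV ▸ hx)
  obtain ⟨-, s, t, s', t', -, -, -, -, h₁, h₂⟩ := hS.exists_coeff
  have d1 : (A.1 *ᵥ n₁) ⬝ᵥ (A.1 *ᵥ n₁) = ρ := by rw [dotProduct_mulVec_mulVec, hS.norm_n₁]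
  have d2 : (C.1 *ᵥ n₂) ⬝ᵥ (C.1 *ᵥ n₂) = ρ := by rw [dotProduct_mulVec_mulVec, hS.norm_n₂]
  have d3 : (D.1 *ᵥ e₂) ⬝ᵥ (D.1 *ᵥ e₂) = ρ := by rw [dotProduct_mulVec_mulVec, hS.norm_e₂]
  have d4 : (B.1 *ᵥ e₁) ⬝ᵥ (B.1 *ᵥ e₁) = ρ := by rw [dotProduct_mulVec_mulVec, hS.norm_e₁]
  have d5 : (A.1 *ᵥ n₁) ⬝ᵥ (D.1 *ᵥ e₂) = e₂ ⬝ᵥ n₁ := by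
    rw [h.hinge_e₂, dotProduct_mulVec_mulVec, dotProduct_comm]
  have d6 : (C.1 *ᵥ n₂) ⬝ᵥ (D.1 *ᵥ e₂) = e₂ ⬝ᵥ n₂ := by
    rw [h.hinge_n₂, dotProduct_mulVec_mulVec, dotProduct_comm]
  have d7 : (A.1 *ᵥ n₁) ⬝ᵥ (B.1 *ᵥ e₁) = e₁ ⬝ᵥ n₁ := by
    rw [h.hinge_n₁, dotProduct_mulVec_mulVec, dotProduct_comm]
  have d8 : (C.1 *ᵥ n₂) ⬝ᵥ (B.1 *ᵥ e₁) = e₁ ⬝ᵥ n₂ := by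
    rw [h.hinge_e₁, dotProduct_mulVec_mulVec, dotProduct_comm]
  obtain ⟨-, c2, -, c4⟩ := h.convex
  rw [triple_swap_right, neg_nonneg] at c2
  rw [triple_rotate, triple_rotate] at c4
  generalize A.1 *ᵥ n₁ = N₁ at *
  generalize C.1 *ᵥ n₂ = N₂ at *
  generalize D.1 *ᵥ e₂ = E₂ at *
  generalize B.1 *ᵥ e₁ = E₁ at *
  have z1 : triple n₁ n₂ e₂ = 0 := by
    rw [h₁, h₂]; simp only [triple_eq, Pi.add_apply, Pi.smul_apply, smul_eq_mul]; ring
  have z2 : triple n₁ n₂ e₁ = 0 := by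
    rw [h₁, h₂]; simp only [triple_eq, Pi.add_apply, Pi.smul_apply, smul_eq_mul]; ring
  have g1 := triple_mul_triple n₁ n₂ e₂ e₂
  have g2 := triple_mul_triple n₁ n₂ e₁ e₁
  have g3 := triple_mul_triple n₁ n₂ e₂ e₁
  have G1 := triple_mul_triple N₁ N₂ E₂ E₂
  have G2 := triple_mul_triple N₁ N₂ E₁ E₁
  have G3 := triple_mul_triple N₁ N₂ E₂ E₁
  rw [z1, hS.norm_n₁, hS.norm_n₂, hS.norm_e₂, dotProduct_comm n₁ e₂, dotProduct_comm n₂ e₂] at g1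
  rw [z2, hS.norm_n₁, hS.norm_n₂, hS.norm_e₁, dotProduct_comm n₁ e₁, dotProduct_comm n₂ e₁] at g2
  rw [z1, hS.norm_n₁, hS.norm_n₂, dotProduct_comm n₁ e₁, dotProduct_comm n₁ e₂,
    dotProduct_comm n₂ e₁, dotProduct_comm n₂ e₂] at g3
  rw [d1, d2, d3, d5, d6, ← hV] at G1
  rw [d1, d2, d4, d7, d8, ← hV] at G2
  rw [d1, d2, d5, d6, d7, d8, ← hV, ← hW] at G3
  refine Kirigami.diagonal_relation (p := triple N₁ N₂ E₂) (q := -triple N₁ N₂ E₁) c4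
    (neg_nonneg.2 c2) hVlt hx ?_ ?_ ?_ ?_ ?_ ?_ ?_
  · linear_combination -g1
  · linear_combination -g2
  · linear_combination -g3
  · have hn₁ : s * e₂ ⬝ᵥ n₁ + t * e₁ ⬝ᵥ n₁ = ρ := by
      rw [← hS.norm_n₁]; nth_rewrite 3 [h₁]; simp
    have hn₂ : s' * e₂ ⬝ᵥ n₂ + t' * e₁ ⬝ᵥ n₂ = ρ := by
      rw [← hS.norm_n₂]; nth_rewrite 3 [h₂]; simp
    have hn₁₂ : n₁ ⬝ᵥ n₂ = s * e₂ ⬝ᵥ n₂ + t * e₁ ⬝ᵥ n₂ := by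
      nth_rewrite 1 [h₁]; simp
    have hle₁ : e₂ ⬝ᵥ n₁ = s * ρ + t * e₂ ⬝ᵥ e₁ := by simp [h₁, hS.norm_e₂]
    have hre₁ : e₁ ⬝ᵥ n₁ = s * e₂ ⬝ᵥ e₁ + t * ρ := by
      simp [h₁, hS.norm_e₁, dotProduct_comm e₁ e₂]
    have hre₂ : e₁ ⬝ᵥ n₂ = s' * e₂ ⬝ᵥ e₁ + t' * ρ := by
      simp [h₂, hS.norm_e₁, dotProduct_comm e₁ e₂]
    have hle₂ : e₂ ⬝ᵥ n₂ = s' * ρ + t' * e₂ ⬝ᵥ e₁ := by simp [h₂, hS.norm_e₂]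
    rw [hle₁, hre₁] at hn₁
    rw [hle₂, hre₂] at hn₂
    rw [hn₁₂, hle₁, hre₁, hle₂, hre₂]
    generalize e₂ ⬝ᵥ e₁ = U at *
    linear_combination (ρ ^ 2 - U ^ 2) *
      ((s' * (s' * ρ + t' * U) + t' * (s' * U + t' * ρ)) * hn₁ + ρ * hn₂)
  · linear_combination G1
  · linear_combination G2
  · linear_combination G3

/-- The openings of the two end hinges of a slit (`BC`, `DA`) are proportional, with a ratio that
depends only on the slit, and so are those of the two interior hinges (`AB`, `CD`). The openings at
the ends are related to those in the interior by the law of deployment, as long as the void is open.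
For a closed hinge only one direction is stated: if `n₁ = n₂`, then the void may also fold up, with
closed end hinges but open interior hinges. -/
theorem IsSlit.exists_law {ρ : ℝ} {n₁ e₁ n₂ e₂ : Vec3} (hS : IsSlit ρ n₁ e₁ n₂ e₂) :
    ∃ a a' b b' : ℝ, 0 < a ∧ 0 < a' ∧ 0 < b ∧ 0 < b' ∧
      (∀ A B C D, IsOpening n₁ e₁ n₂ e₂ A B C D →
        a * hingeOpening B C = a' * hingeOpening D A ∧
        b * hingeOpening A B = b' * hingeOpening C D ∧
        (hingeOpening A B = 0 → hingeOpening B C = 0)) ∧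
      ∀ A B C D A' B' C' D', IsOpening n₁ e₁ n₂ e₂ A B C D → IsOpening n₁ e₁ n₂ e₂ A' B' C' D' →
        0 < hingeOpening B C → 0 < hingeOpening B' C' →
        DeploymentLaw (hingeOpening B C) (hingeOpening A B)
          (hingeOpening B' C') (hingeOpening A' B') := by
  obtain ⟨hU, s, t, s', t', hs, ht, hs', ht', h₁, h₂⟩ := hS.exists_coeff
  have hρ := hS.pos
  have hg : 0 < ρ ^ 2 - (e₂ ⬝ᵥ e₁) ^ 2 := sub_pos.2 hU
  have hx : ∀ A B C D, IsOpening n₁ e₁ n₂ e₂ A B C D → 0 < hingeOpening B C →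
      (A.1 *ᵥ n₁) ⬝ᵥ (C.1 *ᵥ n₂) < n₁ ⬝ᵥ n₂ := fun A B C D h hp => by
    have h2 := (h.hinge_relations hS hs ht hs' h₁ h₂).2.1
    have : 0 < 2 * s * s' * (ρ ^ 2 - (e₂ ⬝ᵥ e₁) ^ 2) * hingeOpening B C := by positivity
    rw [← h2] at this
    exact sub_pos.1 (pos_of_mul_pos_right this hρ.le)
  have hy : ∀ A B C D, IsOpening n₁ e₁ n₂ e₂ A B C D →
      0 ≤ (D.1 *ᵥ e₂) ⬝ᵥ (B.1 *ᵥ e₁) - e₂ ⬝ᵥ e₁ := fun A B C D h => by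
    have h3 := (h.hinge_relations hS hs ht hs' h₁ h₂).2.2.1
    have hp := hingeOpening_nonneg A B
    have : 0 ≤ 2 * s * t * (ρ ^ 2 - (e₂ ⬝ᵥ e₁) ^ 2) * hingeOpening A B := by positivity
    rw [← h3] at this
    exact nonneg_of_mul_nonneg_right this hρ
  refine ⟨2 * s * s' * (ρ ^ 2 - (e₂ ⬝ᵥ e₁) ^ 2), 2 * t * t' * (ρ ^ 2 - (e₂ ⬝ᵥ e₁) ^ 2),
    2 * s * t * (ρ ^ 2 - (e₂ ⬝ᵥ e₁) ^ 2), 2 * s' * t' * (ρ ^ 2 - (e₂ ⬝ᵥ e₁) ^ 2),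
    by positivity, by positivity, by positivity, by positivity, ?_, ?_⟩
  · intro A B C D h
    obtain ⟨k1, k2, k3, k4⟩ := h.hinge_relations hS hs ht hs' h₁ h₂
    refine ⟨k2.symm.trans k1, k3.symm.trans k4, fun h0 => ?_⟩
    by_contra hne
    have hlt := hx A B C D h ((hingeOpening_nonneg B C).lt_of_ne' hne)
    have hr := (h.diagonal_relation hS rfl rfl hlt).2.2
    rw [h0, mul_zero] at k3
    rw [(mul_eq_zero.1 k3).resolve_left hρ.ne', zero_mul] at hr
    exact (mul_pos hg (sub_pos.2 hlt)).ne' hr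
  · intro A B C D A' B' C' D' h h' hp hp'
    obtain ⟨k1, k2, k3, k4⟩ := h.hinge_relations hS hs ht hs' h₁ h₂
    obtain ⟨k1', k2', k3', k4'⟩ := h'.hinge_relations hS hs ht hs' h₁ h₂
    have hlt := hx A B C D h hp
    have hlt' := hx A' B' C' D' h' hp'
    have hyn := hy A B C D h
    have hyn' := hy A' B' C' D' h'
    obtain ⟨ra, rb, r⟩ := h.diagonal_relation hS rfl rfl hlt
    obtain ⟨ra', rb', r'⟩ := h'.diagonal_relation hS rfl rfl hlt'
    refine DeploymentLaw.smul (a := 2 * s * s' * (ρ ^ 2 - (e₂ ⬝ᵥ e₁) ^ 2) / ρ)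
      (b := 2 * s * t * (ρ ^ 2 - (e₂ ⬝ᵥ e₁) ^ 2) / ρ) ?_ (by positivity) (by positivity)
    rw [div_mul_eq_mul_div, div_mul_eq_mul_div, div_mul_eq_mul_div, div_mul_eq_mul_div,
      ← k2, ← k3, ← k2', ← k3']
    simp only [mul_div_cancel_left₀ _ hρ.ne']
    refine ⟨fun hh => mul_lt_mul_of_diagonal_relation hρ hU hlt hyn hyn' ra' rb' r r' hh,
      fun hh => mul_lt_mul_of_diagonal_relation hρ hU hlt' hyn' hyn ra rb r' r hh, fun hh => ?_⟩
    have hVV := sub_right_injective hh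
    rw [← hVV] at r'
    refine mul_right_cancel₀ (fun h0 => ?_) (r.symm.trans r')
    rw [h0, mul_zero] at r
    exact (mul_pos hg (sub_pos.2 hlt)).ne' r

/-- The relative rotations of the panels round a void are determined by the openings of the
hinges. -/
theorem IsOpening.relative_eq {ρ : ℝ} {n₁ e₁ n₂ e₂ : Vec3} {A B C D A' B' C' D' : Rotation}
    (hS : IsSlit ρ n₁ e₁ n₂ e₂) (h : IsOpening n₁ e₁ n₂ e₂ A B C D)
    (h' : IsOpening n₁ e₁ n₂ e₂ A' B' C' D') :
    (hingeOpening A B = hingeOpening A' B' → A⁻¹ * B = A'⁻¹ * B') ∧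
      (hingeOpening B C = hingeOpening B' C' → B⁻¹ * C = B'⁻¹ * C') := by
  obtain ⟨hU, s, t, s', t', hs, ht, hs', ht', h₁, h₂⟩ := hS.exists_coeff
  have hρ := hS.pos
  have hg : 0 < ρ ^ 2 - (e₂ ⬝ᵥ e₁) ^ 2 := sub_pos.2 hU
  have hle₁ : e₂ ⬝ᵥ n₁ = s * ρ + t * e₂ ⬝ᵥ e₁ := by simp [h₁, hS.norm_e₂]
  have hre₁ : e₁ ⬝ᵥ n₁ = s * e₂ ⬝ᵥ e₁ + t * ρ := by
    simp [h₁, hS.norm_e₁, dotProduct_comm e₁ e₂]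
  have hn₁ : s * (s * ρ + t * e₂ ⬝ᵥ e₁) + t * (s * e₂ ⬝ᵥ e₁ + t * ρ) = ρ := by
    rw [← hle₁, ← hre₁, ← hS.norm_n₁]; nth_rewrite 3 [h₁]; simp
  have sense : ∀ A B C D, IsOpening n₁ e₁ n₂ e₂ A B C D →
      0 ≤ triple n₁ e₂ ((A⁻¹ * B).1 *ᵥ e₂) ∧ 0 ≤ -triple e₁ n₁ ((B⁻¹ * C).1 *ᵥ n₁) := by
    intro A B C D h
    have q1 := Rotation.inv_mul_mulVec_eq_self h.hinge_n₁
    have q2 := Rotation.inv_mul_mulVec_eq_self h.hinge_e₁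
    obtain ⟨c1, c2, -, -⟩ := h.convex
    rw [h.hinge_e₂, triple_mulVec_relative] at c1
    rw [h.hinge_n₁, triple_mulVec_relative] at c2
    have v1 : t • e₁ = n₁ + (-s) • e₂ := by rw [h₁]; module
    have v2 : s • n₂ = (s * t' - s' * t) • e₁ + s' • n₁ := by rw [h₁, h₂]; module
    have w1 := congrArg (fun w => triple e₂ n₁ ((A⁻¹ * B).1 *ᵥ w)) v1
    have w2 := congrArg (fun w => triple n₁ e₁ ((B⁻¹ * C).1 *ᵥ w)) v2
    simp only [Matrix.mulVec_add, Matrix.mulVec_smul, triple_add_right, triple_smul_right, q1, q2,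
      triple_self_right] at w1 w2
    rw [triple_swap_left e₂ n₁ ((A⁻¹ * B).1 *ᵥ e₂)] at w1
    rw [triple_swap_left n₁ e₁ ((B⁻¹ * C).1 *ᵥ n₁)] at w2
    constructor
    · have := mul_nonneg ht.le c1
      exact nonneg_of_mul_nonneg_right (by linarith : 0 ≤ s * _) hs
    · have := mul_nonneg hs.le c2
      exact nonneg_of_mul_nonneg_right (by linarith : 0 ≤ s' * _) hs'
  obtain ⟨p1, p2⟩ := sense A B C D h
  obtain ⟨p1', p2'⟩ := sense A' B' C' D' h'
  refine ⟨fun ho => relative_eq_of_hingeOpening_eq (u := e₂) ?_ h.hinge_n₁ h'.hinge_n₁ ho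
    (mul_nonneg p1 p1'), fun ho => relative_eq_of_hingeOpening_eq (u := n₁) ?_ h.hinge_e₁
    h'.hinge_e₁ ho (by rw [← neg_mul_neg]; exact mul_nonneg p2 p2')⟩
  · rw [hS.norm_n₁, hS.norm_e₂, dotProduct_comm, hle₁]
    have : 0 < t ^ 2 * (ρ ^ 2 - (e₂ ⬝ᵥ e₁) ^ 2) := by positivity
    linear_combination this + ρ * hn₁
  · rw [hS.norm_n₁, hS.norm_e₁, hre₁]
    have : 0 < s ^ 2 * (ρ ^ 2 - (e₂ ⬝ᵥ e₁) ^ 2) := by positivity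
    linear_combination this + ρ * hn₁

/-! ### Propagation through the tessellation -/

/-- A property of the hinges of a slit (at the ends: `e`, `e'`, in the interior: `n`, `n'`) which does
not distinguish the two ends, nor the two interior hinges, and which passes from the interior to the
ends. -/
structure PassesToEnds (e e' n n' : Prop) : Prop where
  ends : e ↔ e'
  interior : n ↔ n'
  to_ends : n → e

/-- Round an interior panel there are four voids, and each of the four hinges of the panel is at
the end of one and in the interior of another of the four slits, in cyclic order. So a property
which passes from the interior to the ends of each slit passes along the whole tessellation. Here
`h i j` is the property of the hinge between the panels `(i, j)` and `(i + 1, j)`, and `v i j` is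
that of the hinge between `(i, j)` and `(i, j + 1)`. -/
theorem iff_of_passesToEnds {M N ε : ℕ} (hM : 3 ≤ M) (hN : 3 ≤ N) {h v : ℕ → ℕ → Prop}
    (he : ∀ i j, i + 1 < M → j + 1 < N → Even (i + j + ε) →
      PassesToEnds (v i j) (v (i + 1) j) (h i j) (h i (j + 1)))
    (ho : ∀ i j, i + 1 < M → j + 1 < N → ¬Even (i + j + ε) →
      PassesToEnds (h i j) (h i (j + 1)) (v i j) (v (i + 1) j)) :
    (∀ i j, i + 1 < M → j < N → (h i j ↔ h 0 0)) ∧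
      ∀ i j, i < M → j + 1 < N → (v i j ↔ h 0 0) := by
  have cycle : ∀ a b, a + 2 < M → b + 2 < N →
      (h a b ↔ v a b) ∧ (h (a + 1) b ↔ v (a + 1) b) ∧ (h a (b + 1) ↔ v a (b + 1)) ∧
        (h (a + 1) (b + 1) ↔ v (a + 1) (b + 1)) := by
    intro a b ha hb
    have p1 : Even (a + 1 + b + ε) ↔ ¬Even (a + b + ε) := by
      rw [show a + 1 + b + ε = a + b + ε + 1 by ring, Nat.even_add_one]
    have p2 : Even (a + (b + 1) + ε) ↔ ¬Even (a + b + ε) := by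
      rw [show a + (b + 1) + ε = a + b + ε + 1 by ring, Nat.even_add_one]
    have p3 : Even (a + 1 + (b + 1) + ε) ↔ Even (a + b + ε) := by
      rw [show a + 1 + (b + 1) + ε = a + b + ε + 1 + 1 by ring, Nat.even_add_one,
        Nat.even_add_one, not_not]
    by_cases hp : Even (a + b + ε)
    · obtain ⟨a1, a2, a3⟩ := he a b (by lia) (by lia) hp
      obtain ⟨b1, b2, b3⟩ := ho (a + 1) b (by lia) (by lia) (by rw [p1]; exact not_not.2 hp)
      obtain ⟨c1, c2, c3⟩ := ho a (b + 1) (by lia) (by lia) (by rw [p2]; exact not_not.2 hp)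
      obtain ⟨d1, d2, d3⟩ := he (a + 1) (b + 1) (by lia) (by lia) (p3.2 hp)
      grind
    · obtain ⟨a1, a2, a3⟩ := ho a b (by lia) (by lia) hp
      obtain ⟨b1, b2, b3⟩ := he (a + 1) b (by lia) (by lia) (p1.2 hp)
      obtain ⟨c1, c2, c3⟩ := he a (b + 1) (by lia) (by lia) (p2.2 hp)
      obtain ⟨d1, d2, d3⟩ := ho (a + 1) (b + 1) (by lia) (by lia) (fun h => hp (p3.1 h))
      grind
  have hv : ∀ i j, i + 1 < M → j + 1 < N → (h i j ↔ v i j) := by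
    intro i j hi hj
    rcases Nat.lt_or_ge (i + 2) M with hi' | hi' <;> rcases Nat.lt_or_ge (j + 2) N with hj' | hj'
    · exact (cycle i j hi' hj').1
    · obtain ⟨b, rfl⟩ : ∃ b, j = b + 1 := ⟨j - 1, by lia⟩
      exact (cycle i b hi' (by lia)).2.2.1
    · obtain ⟨a, rfl⟩ : ∃ a, i = a + 1 := ⟨i - 1, by lia⟩
      exact (cycle a j (by lia) hj').2.1
    · obtain ⟨a, rfl⟩ : ∃ a, i = a + 1 := ⟨i - 1, by lia⟩
      obtain ⟨b, rfl⟩ : ∃ b, j = b + 1 := ⟨j - 1, by lia⟩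
      exact (cycle a b (by lia) (by lia)).2.2.2
  have hh : ∀ i j, i + 1 < M → j + 1 < N →
      (h i (j + 1) ↔ h i j) ∧ (v (i + 1) j ↔ v i j) := by
    intro i j hi hj
    by_cases hp : Even (i + j + ε)
    · exact ⟨(he i j hi hj hp).interior.symm, (he i j hi hj hp).ends.symm⟩
    · exact ⟨(ho i j hi hj hp).ends.symm, (ho i j hi hj hp).interior.symm⟩
  have hcol : ∀ i j, i + 1 < M → j < N → (h i j ↔ h i 0) := by
    intro i j hi hj
    induction j with
    | zero => rfl
    | succ j ih => exact (hh i j hi hj).1.trans (ih (by lia))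
  have hrow : ∀ i j, i < M → j + 1 < N → (v i j ↔ v 0 j) := by
    intro i j hi hj
    induction i with
    | zero => rfl
    | succ i ih => exact (hh i j hi hj).2.trans (ih (by lia))
  have hv0 : ∀ i j, i < M → j + 1 < N → (v i j ↔ h 0 0) := by
    intro i j hi hj
    rw [hrow i j hi hj, ← hv 0 j (by lia) hj, hcol 0 j (by lia) (by lia)]
  refine ⟨fun i j hi hj => ?_, hv0⟩
  rw [hcol i j hi hj, hv i 0 hi (by lia), hv0 i 0 (by lia) (by lia)]

/-- The law of deployment of a slit for both of its end hinges and both of its interior hinges. -/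
structure SlitLaw (x₁ x₂ y₁ y₂ x₁' x₂' y₁' y₂' : ℝ) : Prop where
  law₁₁ : DeploymentLaw x₁ y₁ x₁' y₁'
  law₁₂ : DeploymentLaw x₁ y₂ x₁' y₂'
  law₂₁ : DeploymentLaw x₂ y₁ x₂' y₁'
  law₂₂ : DeploymentLaw x₂ y₂ x₂' y₂'

theorem DeploymentLaw.symm {x y x' y' : ℝ} (h : DeploymentLaw x y x' y') :
    DeploymentLaw x' y' x y :=
  ⟨h.gt, h.lt, fun hx => (h.eq hx.symm).symm⟩

theorem SlitLaw.symm {x₁ x₂ y₁ y₂ x₁' x₂' y₁' y₂' : ℝ}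
    (h : SlitLaw x₁ x₂ y₁ y₂ x₁' x₂' y₁' y₂') : SlitLaw x₁' x₂' y₁' y₂' x₁ x₂ y₁ y₂ :=
  ⟨h.law₁₁.symm, h.law₁₂.symm, h.law₂₁.symm, h.law₂₂.symm⟩

theorem DeploymentLaw.lt_iff_lt {x y x' y' : ℝ} (h : DeploymentLaw x y x' y') (hx : 0 < x)
    (hy : 0 < y) (hx' : 0 < x') (hy' : 0 < y') : x < x' ↔ y < y' := by
  have key : ∀ {x y x' y' : ℝ}, DeploymentLaw x y x' y' → 0 < x' → 0 < y' → x < x' → y < y' :=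
    fun h hx' hy' hlt => lt_of_mul_lt_mul_right
      ((h.lt hlt).trans (mul_lt_mul_of_pos_left hlt hy')) hx'.le
  refine ⟨key h hx' hy', fun hlt => ?_⟩
  rcases lt_trichotomy x x' with h1 | h1 | h1
  · exact h1
  · exact absurd (h.eq h1) hlt.ne
  · exact absurd (key h.symm hx hy h1) hlt.not_gt

theorem SlitLaw.passesToEnds {x₁ x₂ y₁ y₂ x₁' x₂' y₁' y₂' : ℝ}
    (h : SlitLaw x₁ x₂ y₁ y₂ x₁' x₂' y₁' y₂') (hx₁ : 0 < x₁) (hx₂ : 0 < x₂) (hy₁ : 0 < y₁)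
    (hy₂ : 0 < y₂) (hx₁' : 0 < x₁') (hx₂' : 0 < x₂') (hy₁' : 0 < y₁') (hy₂' : 0 < y₂') :
    PassesToEnds (x₁ < x₁') (x₂ < x₂') (y₁ < y₁') (y₂ < y₂') := by
  have a := h.law₁₁.lt_iff_lt hx₁ hy₁ hx₁' hy₁'
  have b := h.law₁₂.lt_iff_lt hx₁ hy₂ hx₁' hy₂'
  have c := h.law₂₁.lt_iff_lt hx₂ hy₁ hx₂' hy₁'
  exact ⟨a.trans c.symm, a.symm.trans b, a.2⟩

/-- The ratios of consecutive openings round a panel have product one, so they cannot all be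
larger in one configuration than in another. -/
theorem false_of_cycle {p q r s p' q' r' s' : ℝ} (hp : 0 < p) (hq : 0 < q) (hr : 0 < r)
    (hs : 0 < s) (hp' : 0 < p') (hq' : 0 < q') (hr' : 0 < r') (hs' : 0 < s')
    (h₁ : q * p' < q' * p) (h₂ : r * q' < r' * q) (h₃ : s * r' < s' * r)
    (h₄ : p * s' < p' * s) : False := by
  have h₁₂ := mul_lt_mul'' h₁ h₂ (by positivity) (by positivity)
  have h₃₄ := mul_lt_mul'' h₃ h₄ (by positivity) (by positivity)
  have := mul_lt_mul'' h₁₂ h₃₄ (by positivity) (by positivity)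
  exact this.ne (by ring)

/-- Two families of positive openings which satisfy the law of deployment at every slit are equal.
-/
theorem eq_of_slitLaw {M N ε : ℕ} (hM : 3 ≤ M) (hN : 3 ≤ N) {h v h' v' : ℕ → ℕ → ℝ}
    (hh : ∀ i j, i + 1 < M → j < N → 0 < h i j) (hv : ∀ i j, i < M → j + 1 < N → 0 < v i j)
    (hh' : ∀ i j, i + 1 < M → j < N → 0 < h' i j) (hv' : ∀ i j, i < M → j + 1 < N → 0 < v' i j)
    (he : ∀ i j, i + 1 < M → j + 1 < N → Even (i + j + ε) →
      SlitLaw (v i j) (v (i + 1) j) (h i j) (h i (j + 1))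
        (v' i j) (v' (i + 1) j) (h' i j) (h' i (j + 1)))
    (ho : ∀ i j, i + 1 < M → j + 1 < N → ¬Even (i + j + ε) →
      SlitLaw (h i j) (h i (j + 1)) (v i j) (v (i + 1) j)
        (h' i j) (h' i (j + 1)) (v' i j) (v' (i + 1) j)) :
    (∀ i j, i + 1 < M → j < N → h i j = h' i j) ∧
      ∀ i j, i < M → j + 1 < N → v i j = v' i j := by
  have key : ∀ {h v h' v' : ℕ → ℕ → ℝ},
      (∀ i j, i + 1 < M → j < N → 0 < h i j) → (∀ i j, i < M → j + 1 < N → 0 < v i j) →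
      (∀ i j, i + 1 < M → j < N → 0 < h' i j) → (∀ i j, i < M → j + 1 < N → 0 < v' i j) →
      (∀ i j, i + 1 < M → j + 1 < N → Even (i + j + ε) →
        SlitLaw (v i j) (v (i + 1) j) (h i j) (h i (j + 1))
          (v' i j) (v' (i + 1) j) (h' i j) (h' i (j + 1))) →
      (∀ i j, i + 1 < M → j + 1 < N → ¬Even (i + j + ε) →
        SlitLaw (h i j) (h i (j + 1)) (v i j) (v (i + 1) j)
          (h' i j) (h' i (j + 1)) (v' i j) (v' (i + 1) j)) →
      (∀ i j, i + 1 < M → j < N → ¬h i j < h' i j) ∧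
        ∀ i j, i < M → j + 1 < N → ¬v i j < v' i j := by
    intro h v h' v' hh hv hh' hv' he ho
    obtain ⟨eh, ev⟩ := iff_of_passesToEnds (ε := ε) hM hN
      (h := fun i j => h i j < h' i j) (v := fun i j => v i j < v' i j)
      (fun i j hi hj hp => (he i j hi hj hp).passesToEnds (hv _ _ (by lia) hj) (hv _ _ hi hj)
        (hh _ _ hi (by lia)) (hh _ _ hi hj) (hv' _ _ (by lia) hj) (hv' _ _ hi hj)
        (hh' _ _ hi (by lia)) (hh' _ _ hi hj))
      (fun i j hi hj hp => (ho i j hi hj hp).passesToEnds (hh _ _ hi (by lia)) (hh _ _ hi hj)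
        (hv _ _ (by lia) hj) (hv _ _ hi hj) (hh' _ _ hi (by lia)) (hh' _ _ hi hj)
        (hv' _ _ (by lia) hj) (hv' _ _ hi hj))
    have h00 : ¬h 0 0 < h' 0 0 := by
      intro hlt
      have lS := (ev 1 0 (by lia) (by lia)).2 hlt
      have lN := (ev 1 1 (by lia) (by lia)).2 hlt
      have lW := (eh 0 1 (by lia) (by lia)).2 hlt
      have lE := (eh 1 1 (by lia) (by lia)).2 hlt
      have pS := hv 1 0 (by lia) (by lia)
      have pN := hv 1 1 (by lia) (by lia)
      have pW := hh 0 1 (by lia) (by lia)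
      have pE := hh 1 1 (by lia) (by lia)
      have pS' := hv' 1 0 (by lia) (by lia)
      have pN' := hv' 1 1 (by lia) (by lia)
      have pW' := hh' 0 1 (by lia) (by lia)
      have pE' := hh' 1 1 (by lia) (by lia)
      by_cases hp : Even ε
      · have l1 := he 0 0 (by lia) (by lia) (by grind)
        have l2 := ho 0 1 (by lia) (by lia) (by grind)
        have l3 := he 1 1 (by lia) (by lia) (by grind)
        have l4 := ho 1 0 (by lia) (by lia) (by grind)
        exact false_of_cycle pS pW pN pE pS' pW' pN' pE' (l1.law₂₂.lt lS) (l2.law₁₂.lt lW)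
          (l3.law₁₁.lt lN) (l4.law₂₁.lt lE)
      · have l1 := ho 0 0 (by lia) (by lia) (by grind)
        have l2 := he 1 0 (by lia) (by lia) (by grind)
        have l3 := ho 1 1 (by lia) (by lia) (by grind)
        have l4 := he 0 1 (by lia) (by lia) (by grind)
        exact false_of_cycle pW pS pE pN pW' pS' pE' pN' (l1.law₂₂.lt lW) (l2.law₁₂.lt lS)
          (l3.law₁₁.lt lE) (l4.law₂₁.lt lN)
    exact ⟨fun i j hi hj hlt => h00 ((eh i j hi hj).1 hlt),
      fun i j hi hj hlt => h00 ((ev i j hi hj).1 hlt)⟩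
  obtain ⟨k1, k2⟩ := key hh hv hh' hv' he ho
  obtain ⟨k3, k4⟩ := key hh' hv' hh hv (fun i j hi hj hp => (he i j hi hj hp).symm)
    (fun i j hi hj hp => (ho i j hi hj hp).symm)
  exact ⟨fun i j hi hj => le_antisymm (not_lt.1 (k3 i j hi hj)) (not_lt.1 (k1 i j hi hj)),
    fun i j hi hj => le_antisymm (not_lt.1 (k4 i j hi hj)) (not_lt.1 (k2 i j hi hj))⟩

theorem IsOpening.passesToEnds {ρ : ℝ} {n₁ e₁ n₂ e₂ : Vec3} {A B C D : Rotation}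
    (hS : IsSlit ρ n₁ e₁ n₂ e₂) (h : IsOpening n₁ e₁ n₂ e₂ A B C D) :
    PassesToEnds (hingeOpening B C = 0) (hingeOpening D A = 0) (hingeOpening A B = 0)
      (hingeOpening C D = 0) := by
  obtain ⟨a, a', b, b', ha, ha', hb, hb', hl, -⟩ := hS.exists_law
  obtain ⟨h1, h2, h3⟩ := hl A B C D h
  have key : ∀ {a a' x x' : ℝ}, 0 < a → 0 < a' → a * x = a' * x' → (x = 0 ↔ x' = 0) :=
    fun ha ha' h => ⟨fun hx => by simpa [hx, ha'.ne'] using h.symm,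
      fun hx => by simpa [hx, ha.ne'] using h⟩
  exact ⟨key ha ha' h1, key hb hb' h2, h3⟩

theorem IsOpening.slitLaw {ρ : ℝ} {n₁ e₁ n₂ e₂ : Vec3} {A B C D A' B' C' D' : Rotation}
    (hS : IsSlit ρ n₁ e₁ n₂ e₂) (h : IsOpening n₁ e₁ n₂ e₂ A B C D)
    (h' : IsOpening n₁ e₁ n₂ e₂ A' B' C' D') (hp : 0 < hingeOpening B C)
    (hp' : 0 < hingeOpening B' C') :
    SlitLaw (hingeOpening B C) (hingeOpening D A) (hingeOpening A B) (hingeOpening C D)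
      (hingeOpening B' C') (hingeOpening D' A') (hingeOpening A' B') (hingeOpening C' D') := by
  obtain ⟨a, a', b, b', ha, ha', hb, hb', hl, hlaw⟩ := hS.exists_law
  obtain ⟨h1, h2, -⟩ := hl A B C D h
  obtain ⟨h1', h2', -⟩ := hl A' B' C' D' h'
  have e1 : hingeOpening B C = a' / a * hingeOpening D A := by field_simp; linarith
  have e2 : hingeOpening A B = b' / b * hingeOpening C D := by field_simp; linarith
  have e1' : hingeOpening B' C' = a' / a * hingeOpening D' A' := by field_simp; linarith
  have e2' : hingeOpening A' B' = b' / b * hingeOpening C' D' := by field_simp; linarith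
  have k := hlaw A B C D A' B' C' D' h h' hp hp'
  refine ⟨k, ?_, ?_, ?_⟩
  · rw [e2, e2', ← one_mul (hingeOpening B C), ← one_mul (hingeOpening B' C')] at k
    exact k.smul one_pos (by positivity)
  · rw [e1, e1', ← one_mul (hingeOpening A B), ← one_mul (hingeOpening A' B')] at k
    exact k.smul (by positivity) one_pos
  · rw [e1, e1', e2, e2'] at k
    exact k.smul (by positivity) (by positivity)

/-! ### Configurations of a tessellation -/

theorem IsSlit.weaklyConvex {ρ : ℝ} {n₁ e₁ n₂ e₂ : Vec3} (hS : IsSlit ρ n₁ e₁ n₂ e₂) :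
    WeaklyConvex n₁ e₁ n₂ e₂ := by
  obtain ⟨-, s, t, s', t', -, -, -, -, h₁, h₂⟩ := hS.exists_coeff
  subst h₁ h₂
  refine ⟨le_of_eq ?_, le_of_eq ?_, le_of_eq ?_, le_of_eq ?_⟩ <;>
  · simp only [triple_eq, Pi.add_apply, Pi.smul_apply, smul_eq_mul]; ring

theorem WeaklyConvex.rotate {p q r s : Vec3} (h : WeaklyConvex p q r s) : WeaklyConvex q r s p :=
  ⟨h.2.1, h.2.2.1, h.2.2.2, h.1⟩

namespace SQKTessellation

variable {K : ℝ} {M N : ℕ}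

/-- The rotations of the panels of a placement, indexed by natural numbers (with the value `1`
outside the tessellation). -/
def rotationAt (R : Fin M → Fin N → Rotation) (i j : ℕ) : Rotation :=
  if h : i < M ∧ j < N then R ⟨i, h.1⟩ ⟨j, h.2⟩ else 1

theorem rotationAt_of_lt (R : Fin M → Fin N → Rotation) {i j : ℕ} (hi : i < M) (hj : j < N) :
    rotationAt R i j = R ⟨i, hi⟩ ⟨j, hj⟩ := dif_pos ⟨hi, hj⟩

/-- The opening of the hinge between the panels `(i, j)` and `(i + 1, j)`. -/
def rowOpening (R : Fin M → Fin N → Rotation) (i j : ℕ) : ℝ :=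
  hingeOpening (rotationAt R i j) (rotationAt R (i + 1) j)

/-- The opening of the hinge between the panels `(i, j)` and `(i, j + 1)`. -/
def columnOpening (R : Fin M → Fin N → Rotation) (i j : ℕ) : ℝ :=
  hingeOpening (rotationAt R i j) (rotationAt R i (j + 1))

theorem isSlit_horizontal (hK : 0 < K) (T : SQKTessellation K M N) {i i' : Fin M} {j j' : Fin N}
    (hi : i.val + 1 = i'.val) (hj : j.val + 1 = j'.val) (hp : Even (i.val + j.val + T.parity)) :
    IsSlit (1 / K) (T.east i j) (T.north i' j) (T.east i j') (T.north i j) :=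
  ⟨one_div_pos.2 hK, T.north_onSphere _ _, T.north_onSphere _ _, T.east_onSphere _ _,
    T.east_onSphere _ _, (T.slit_horizontal i i' j j' hi hj hp).1,
    (T.slit_horizontal i i' j j' hi hj hp).2⟩

theorem isSlit_vertical (hK : 0 < K) (T : SQKTessellation K M N) {i i' : Fin M} {j j' : Fin N}
    (hi : i.val + 1 = i'.val) (hj : j.val + 1 = j'.val) (hp : ¬Even (i.val + j.val + T.parity)) :
    IsSlit (1 / K) (T.north i' j) (T.east i j') (T.north i j) (T.east i j) :=
  ⟨one_div_pos.2 hK, T.east_onSphere _ _, T.east_onSphere _ _, T.north_onSphere _ _,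
    T.north_onSphere _ _, (T.slit_vertical i i' j j' hi hj hp).2,
    (T.slit_vertical i i' j j' hi hj hp).1⟩

theorem isCompatible_undeployed (hK : 0 < K) (T : SQKTessellation K M N) :
    T.IsCompatible (undeployed M N) where
  hinge_row i i' j h := by rw [T.hinge_row i i' j h]; rfl
  hinge_column i j j' h := by rw [T.hinge_column i j j' h]; rfl
  opening i i' j j' hi hj := by
    simp only [undeployed, OneMemClass.coe_one, Matrix.one_mulVec]
    by_cases hp : Even (i.val + j.val + T.parity)
    · exact (T.isSlit_horizontal hK hi hj hp).weaklyConvex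
    · exact (T.isSlit_vertical hK hi hj hp).weaklyConvex.rotate.rotate.rotate

variable {T : SQKTessellation K M N} {R R' : Fin M → Fin N → Rotation}

theorem IsCompatible.isOpening_horizontal (h : T.IsCompatible R) {i i' : Fin M} {j j' : Fin N}
    (hi : i.val + 1 = i'.val) (hj : j.val + 1 = j'.val) :
    IsOpening (T.east i j) (T.north i' j) (T.east i j') (T.north i j)
      (R i j) (R i' j) (R i' j') (R i j') := by
  have b := h.hinge_row i i' j hi
  have t := h.hinge_row i i' j' hi
  have l := h.hinge_column i j j' hj
  have r := h.hinge_column i' j j' hj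
  rw [← T.hinge_row i i' j hi] at b
  rw [← T.hinge_row i i' j' hi] at t
  rw [← T.hinge_column i j j' hj] at l
  rw [← T.hinge_column i' j j' hj] at r
  exact ⟨b, r, t.symm, l.symm, by rw [← t, ← l]; exact h.opening i i' j j' hi hj⟩

theorem IsCompatible.isOpening_vertical (h : T.IsCompatible R) {i i' : Fin M} {j j' : Fin N}
    (hi : i.val + 1 = i'.val) (hj : j.val + 1 = j'.val) :
    IsOpening (T.north i' j) (T.east i j') (T.north i j) (T.east i j)
      (R i' j) (R i' j') (R i j') (R i j) := by
  have k := h.isOpening_horizontal hi hj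
  refine ⟨k.hinge_e₁, k.hinge_n₂, k.hinge_e₂, k.hinge_n₁, ?_⟩
  exact k.convex.rotate

/-- The four panels round a void, with natural numbers as indices. -/
theorem rotationAt_block (R : Fin M → Fin N → Rotation) {i j : ℕ} (hi : i + 1 < M)
    (hj : j + 1 < N) :
    rotationAt R i j = R ⟨i, by lia⟩ ⟨j, by lia⟩ ∧
      rotationAt R (i + 1) j = R ⟨i + 1, hi⟩ ⟨j, by lia⟩ ∧
      rotationAt R (i + 1) (j + 1) = R ⟨i + 1, hi⟩ ⟨j + 1, hj⟩ ∧
      rotationAt R i (j + 1) = R ⟨i, by lia⟩ ⟨j + 1, hj⟩ :=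
  ⟨rotationAt_of_lt R _ _, rotationAt_of_lt R _ _, rotationAt_of_lt R _ _, rotationAt_of_lt R _ _⟩

/-- The slit between four panels, together with all its openings. -/
theorem exists_slit (hK : 0 < K) (T : SQKTessellation K M N) {i j : ℕ} (hi : i + 1 < M)
    (hj : j + 1 < N) :
    (Even (i + j + T.parity) → ∃ n₁ e₁ n₂ e₂, IsSlit (1 / K) n₁ e₁ n₂ e₂ ∧
      ∀ R, T.IsCompatible R → IsOpening n₁ e₁ n₂ e₂ (rotationAt R i j) (rotationAt R (i + 1) j)
        (rotationAt R (i + 1) (j + 1)) (rotationAt R i (j + 1))) ∧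
    (¬Even (i + j + T.parity) → ∃ n₁ e₁ n₂ e₂, IsSlit (1 / K) n₁ e₁ n₂ e₂ ∧
      ∀ R, T.IsCompatible R → IsOpening n₁ e₁ n₂ e₂ (rotationAt R (i + 1) j)
        (rotationAt R (i + 1) (j + 1)) (rotationAt R i (j + 1)) (rotationAt R i j)) := by
  refine ⟨fun hp => ⟨_, _, _, _, T.isSlit_horizontal hK (i := ⟨i, by lia⟩) (i' := ⟨i + 1, hi⟩)
    (j := ⟨j, by lia⟩) (j' := ⟨j + 1, hj⟩) rfl rfl hp, fun R hR => ?_⟩,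
    fun hp => ⟨_, _, _, _, T.isSlit_vertical hK (i := ⟨i, by lia⟩) (i' := ⟨i + 1, hi⟩)
    (j := ⟨j, by lia⟩) (j' := ⟨j + 1, hj⟩) rfl rfl hp, fun R hR => ?_⟩⟩
  · obtain ⟨h1, h2, h3, h4⟩ := rotationAt_block R hi hj
    rw [h1, h2, h3, h4]
    exact hR.isOpening_horizontal rfl rfl
  · obtain ⟨h1, h2, h3, h4⟩ := rotationAt_block R hi hj
    rw [h1, h2, h3, h4]
    exact hR.isOpening_vertical rfl rfl

/-- Either all hinges are closed or all are open. -/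
theorem IsCompatible.opening_eq_zero_iff (hK : 0 < K) (hM : 3 ≤ M) (hN : 3 ≤ N)
    (h : T.IsCompatible R) :
    (∀ i j, i + 1 < M → j < N → (rowOpening R i j = 0 ↔ rowOpening R 0 0 = 0)) ∧
      ∀ i j, i < M → j + 1 < N → (columnOpening R i j = 0 ↔ rowOpening R 0 0 = 0) := by
  refine iff_of_passesToEnds (ε := T.parity) hM hN (h := fun i j => rowOpening R i j = 0)
    (v := fun i j => columnOpening R i j = 0) (fun i j hi hj hp => ?_) (fun i j hi hj hp => ?_)
  · obtain ⟨n₁, e₁, n₂, e₂, hS, ho⟩ := (T.exists_slit hK hi hj).1 hp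
    obtain ⟨k1, k2, k3⟩ := (ho R h).passesToEnds hS
    rw [hingeOpening_comm (rotationAt R i (j + 1))] at k1
    rw [hingeOpening_comm (rotationAt R (i + 1) (j + 1))] at k2
    exact ⟨k1.symm, k2, fun hn => k1.1 (k3 hn)⟩
  · obtain ⟨n₁, e₁, n₂, e₂, hS, ho⟩ := (T.exists_slit hK hi hj).2 hp
    obtain ⟨k1, k2, k3⟩ := (ho R h).passesToEnds hS
    rw [hingeOpening_comm (rotationAt R (i + 1) (j + 1))] at k1 k3
    rw [hingeOpening_comm (rotationAt R i (j + 1))] at k2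
    exact ⟨k1.symm, k2.symm, fun hn => k1.1 (k3 (k2.2 hn))⟩

/-- Two deployed configurations have equal openings. -/
theorem IsCompatible.opening_eq (hK : 0 < K) (hM : 3 ≤ M) (hN : 3 ≤ N)
    (h : T.IsCompatible R) (h' : T.IsCompatible R') (h0 : rowOpening R 0 0 ≠ 0)
    (h0' : rowOpening R' 0 0 ≠ 0) :
    (∀ i j, i + 1 < M → j < N → rowOpening R i j = rowOpening R' i j) ∧
      ∀ i j, i < M → j + 1 < N → columnOpening R i j = columnOpening R' i j := by
  have hz := h.opening_eq_zero_iff hK hM hN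
  have hz' := h'.opening_eq_zero_iff hK hM hN
  have pr : ∀ i j, i + 1 < M → j < N → 0 < rowOpening R i j := fun i j hi hj =>
    (hingeOpening_nonneg _ _).lt_of_ne' fun he => h0 ((hz.1 i j hi hj).1 he)
  have pc : ∀ i j, i < M → j + 1 < N → 0 < columnOpening R i j := fun i j hi hj =>
    (hingeOpening_nonneg _ _).lt_of_ne' fun he => h0 ((hz.2 i j hi hj).1 he)
  have pr' : ∀ i j, i + 1 < M → j < N → 0 < rowOpening R' i j := fun i j hi hj =>
    (hingeOpening_nonneg _ _).lt_of_ne' fun he => h0' ((hz'.1 i j hi hj).1 he)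
  have pc' : ∀ i j, i < M → j + 1 < N → 0 < columnOpening R' i j := fun i j hi hj =>
    (hingeOpening_nonneg _ _).lt_of_ne' fun he => h0' ((hz'.2 i j hi hj).1 he)
  refine eq_of_slitLaw (ε := T.parity) hM hN pr pc pr' pc' (fun i j hi hj hp => ?_)
    (fun i j hi hj hp => ?_)
  · obtain ⟨n₁, e₁, n₂, e₂, hS, ho⟩ := (T.exists_slit hK hi hj).1 hp
    obtain ⟨k1, k2, k3, k4⟩ := (ho R h).slitLaw hS (ho R' h') (pc _ _ hi hj) (pc' _ _ hi hj)
    rw [hingeOpening_comm (rotationAt R (i + 1) (j + 1)),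
      hingeOpening_comm (rotationAt R' (i + 1) (j + 1))] at k2
    rw [hingeOpening_comm (rotationAt R i (j + 1)),
      hingeOpening_comm (rotationAt R' i (j + 1))] at k3
    rw [hingeOpening_comm (rotationAt R i (j + 1)) (rotationAt R i j),
      hingeOpening_comm (rotationAt R' i (j + 1)) (rotationAt R' i j),
      hingeOpening_comm (rotationAt R (i + 1) (j + 1)),
      hingeOpening_comm (rotationAt R' (i + 1) (j + 1))] at k4
    exact ⟨k3, k4, k1, k2⟩
  · obtain ⟨n₁, e₁, n₂, e₂, hS, ho⟩ := (T.exists_slit hK hi hj).2 hp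
    have q := pr i (j + 1) hi hj
    have q' := pr' i (j + 1) hi hj
    rw [rowOpening, hingeOpening_comm] at q q'
    obtain ⟨k1, k2, k3, k4⟩ := (ho R h).slitLaw hS (ho R' h') q q'
    rw [hingeOpening_comm (rotationAt R (i + 1) (j + 1)),
      hingeOpening_comm (rotationAt R' (i + 1) (j + 1))] at k1
    rw [hingeOpening_comm (rotationAt R i (j + 1)) (rotationAt R i j),
      hingeOpening_comm (rotationAt R' i (j + 1)) (rotationAt R' i j),
      hingeOpening_comm (rotationAt R (i + 1) (j + 1)),
      hingeOpening_comm (rotationAt R' (i + 1) (j + 1))] at k2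
    rw [hingeOpening_comm (rotationAt R i (j + 1)),
      hingeOpening_comm (rotationAt R' i (j + 1))] at k4
    exact ⟨k4, k3, k2, k1⟩

theorem mul_inv_eq_mul_inv_of_inv_mul_eq {G : Type*} [Group G] {a b a' b' : G}
    (h : a⁻¹ * b = a'⁻¹ * b') : b' * b⁻¹ = a' * a⁻¹ := by
  rw [inv_mul_eq_iff_eq_mul] at h
  rw [h]
  group

/-- Compatible placements with equal openings are the same configuration. -/
theorem IsCompatible.exists_eq_mul (hK : 0 < K) (hM : 2 ≤ M) (hN : 2 ≤ N)
    (h : T.IsCompatible R) (h' : T.IsCompatible R')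
    (hr : ∀ i j, i + 1 < M → j < N → rowOpening R i j = rowOpening R' i j)
    (hc : ∀ i j, i < M → j + 1 < N → columnOpening R i j = columnOpening R' i j) :
    ∃ Q : Rotation, ∀ i j, R' i j = Q * R i j := by
  have hblock : ∀ i j, i + 1 < M → j + 1 < N →
      (rotationAt R i j)⁻¹ * rotationAt R (i + 1) j =
        (rotationAt R' i j)⁻¹ * rotationAt R' (i + 1) j ∧
      (rotationAt R (i + 1) j)⁻¹ * rotationAt R (i + 1) (j + 1) =
        (rotationAt R' (i + 1) j)⁻¹ * rotationAt R' (i + 1) (j + 1) ∧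
      (rotationAt R (i + 1) (j + 1))⁻¹ * rotationAt R i (j + 1) =
        (rotationAt R' (i + 1) (j + 1))⁻¹ * rotationAt R' i (j + 1) ∧
      (rotationAt R i (j + 1))⁻¹ * rotationAt R i j =
        (rotationAt R' i (j + 1))⁻¹ * rotationAt R' i j := by
    intro i j hi hj
    have b := hr i j hi (by lia)
    have t := hr i (j + 1) hi hj
    have l := hc i j (by lia) hj
    have r := hc (i + 1) j hi hj
    rw [rowOpening, rowOpening] at b t
    rw [columnOpening, columnOpening] at l r
    rw [hingeOpening_comm, hingeOpening_comm (rotationAt R' i (j + 1))] at t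
    rw [hingeOpening_comm, hingeOpening_comm (rotationAt R' i j)] at l
    by_cases hp : Even (i + j + T.parity)
    · obtain ⟨n₁, e₁, n₂, e₂, hS, ho⟩ := (T.exists_slit hK hi hj).1 hp
      have k := (ho R h).relative_eq hS (ho R' h')
      have k' := (ho R h).symm.relative_eq hS.symm (ho R' h').symm
      exact ⟨k.1 b, k.2 r, k'.1 t, k'.2 l⟩
    · obtain ⟨n₁, e₁, n₂, e₂, hS, ho⟩ := (T.exists_slit hK hi hj).2 hp
      have k := (ho R h).relative_eq hS (ho R' h')
      have k' := (ho R h).symm.relative_eq hS.symm (ho R' h').symm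
      exact ⟨k'.2 b, k.1 r, k.2 t, k'.1 l⟩
  -- The quotient of the two placements is the same at neighbouring panels.
  have hcol : ∀ i j, i < M → j < N →
      rotationAt R' i j * (rotationAt R i j)⁻¹ = rotationAt R' i 0 * (rotationAt R i 0)⁻¹ := by
    intro i j hi hj
    induction j with
    | zero => rfl
    | succ j ih =>
      refine Eq.trans ?_ (ih (by lia))
      rcases Nat.lt_or_ge (i + 1) M with hi' | hi'
      · exact (mul_inv_eq_mul_inv_of_inv_mul_eq (hblock i j hi' hj).2.2.2).symm
      · obtain ⟨a, rfl⟩ : ∃ a, i = a + 1 := ⟨i - 1, by lia⟩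
        exact mul_inv_eq_mul_inv_of_inv_mul_eq (hblock a j hi hj).2.1
  have hrow : ∀ i, i < M →
      rotationAt R' i 0 * (rotationAt R i 0)⁻¹ = rotationAt R' 0 0 * (rotationAt R 0 0)⁻¹ := by
    intro i hi
    induction i with
    | zero => rfl
    | succ i ih =>
      exact (mul_inv_eq_mul_inv_of_inv_mul_eq (hblock i 0 hi (by lia)).1).trans (ih (by lia))
  refine ⟨rotationAt R' 0 0 * (rotationAt R 0 0)⁻¹, fun i j => ?_⟩
  have e := (hcol i j i.2 j.2).trans (hrow i i.2)
  rw [rotationAt_of_lt R' i.2 j.2, rotationAt_of_lt R i.2 j.2] at e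
  rw [← e, inv_mul_cancel_right]

theorem rowOpening_undeployed (i j : ℕ) : rowOpening (undeployed M N) i j = 0 := by
  have h : ∀ i j, rotationAt (undeployed M N) i j = 1 := fun i j => by
    unfold rotationAt undeployed; split <;> rfl
  rw [rowOpening, h, h, hingeOpening_self]

/-- Any two deployed placements, and any two placements which are not deployed, are the same
configuration. -/
theorem IsCompatible.exists_eq_mul_of_iff (hK : 0 < K) (hM : 3 ≤ M) (hN : 3 ≤ N)
    (h : T.IsCompatible R) (h' : T.IsCompatible R')
    (h0 : rowOpening R 0 0 = 0 ↔ rowOpening R' 0 0 = 0) :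
    ∃ Q : Rotation, ∀ i j, R' i j = Q * R i j := by
  by_cases hz : rowOpening R 0 0 = 0
  · have k := h.opening_eq_zero_iff hK hM hN
    have k' := h'.opening_eq_zero_iff hK hM hN
    exact h.exists_eq_mul hK (by lia) (by lia) h'
      (fun i j hi hj => ((k.1 i j hi hj).2 hz).trans ((k'.1 i j hi hj).2 (h0.1 hz)).symm)
      (fun i j hi hj => ((k.2 i j hi hj).2 hz).trans ((k'.2 i j hi hj).2 (h0.1 hz)).symm)
  · have k := h.opening_eq hK hM hN h' hz fun hz' => hz (h0.2 hz')
    exact h.exists_eq_mul hK (by lia) (by lia) h' k.1 k.2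

end SQKTessellation

end Kirigami

end

/-- A spherical quadrilateral kirigami tessellation has one or two compatible configurations, and
the undeployed state is one of them. -/
theorem theorem1 {K : ℝ} (hK : 0 < K) {M N : ℕ} (hM : 3 ≤ M) (hN : 3 ≤ N)
    (T : Kirigami.SQKTessellation K M N) :
    T.IsCompatible (Kirigami.SQKTessellation.undeployed M N) ∧
      (Nat.card T.CompatibleConfiguration = 1 ∨ Nat.card T.CompatibleConfiguration = 2) := by
  have h₀ := T.isCompatible_undeployed hK
  refine ⟨h₀, ?_⟩
  let q₀ : T.CompatibleConfiguration := Quotient.mk T.sameConfiguration ⟨_, h₀⟩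
  by_cases hall : ∀ R, T.IsCompatible R → Kirigami.SQKTessellation.rowOpening R 0 0 = 0
  · left
    rw [Nat.card_eq_one_iff_exists]
    refine ⟨q₀, fun q => ?_⟩
    induction q using Quotient.inductionOn with | h R => ?_
    exact Quotient.sound (R.2.exists_eq_mul_of_iff hK hM hN h₀
      (iff_of_true (hall R.1 R.2) (Kirigami.SQKTessellation.rowOpening_undeployed 0 0)))
  · right
    push Not at hall
    obtain ⟨R₁, h₁, hne⟩ := hall
    rw [Nat.card_eq_two_iff]
    refine ⟨q₀, Quotient.mk T.sameConfiguration ⟨R₁, h₁⟩, fun he => hne ?_,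
      Set.eq_univ_of_forall fun q => ?_⟩
    · obtain ⟨Q, hQ⟩ := Quotient.exact he
      have hQ' : ∀ i j, R₁ i j = Q := fun i j => (hQ i j).trans (mul_one Q)
      rw [Kirigami.SQKTessellation.rowOpening,
        Kirigami.SQKTessellation.rotationAt_of_lt R₁ (by lia) (by lia),
        Kirigami.SQKTessellation.rotationAt_of_lt R₁ (by lia) (by lia), hQ', hQ',
        Kirigami.hingeOpening_self]
    · induction q using Quotient.inductionOn with | h R => ?_
      by_cases hz : Kirigami.SQKTessellation.rowOpening R.1 0 0 = 0
      · left
        exact Quotient.sound (R.2.exists_eq_mul_of_iff hK hM hN h₀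
          (iff_of_true hz (Kirigami.SQKTessellation.rowOpening_undeployed 0 0)))
      · right
        exact Quotient.sound (R.2.exists_eq_mul_of_iff hK hM hN h₁ (iff_of_false hz hne))
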